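/- Let $t,\alpha_+,\alpha_-\ge 0$. Consider the Hammersley process with sources on the boundary: mark points in the unit square $[0,1]^2$ according to three independent homogeneous Poisson processes, one of intensity $t^2$ in the square, one of intensity $\alpha_+t$ on the edge $x=0$, and one of intensity $\alpha_-t$ on the edge $y=0$ (with no additional weight at the origin). Let $L(t,\alpha_+,\alpha_-)$ be the length of the longest up/right path, that is, the maximal number of marked points that can be arranged in a sequence with both coordinates weakly increasing. For integers $l\ge 0$ put $$\tilde D_l=\Big\langle \prod_{j=1}^l (1+\alpha_+e^{i\theta_j})(1+\alpha_-e^{-i\theta_j})\,e^{2t\sum_{j=1}^l\cos\theta_j}\Big\rangle_{U(l)},$$ where $\langle\cdot\rangle_{U(l)}$ is the average over the eigenvalues $e^{i\theta_1},\dots,e^{i\theta_l}$ of a Haar random matrix of $U(l)$, i.e. with respect to the density $$\frac{1}{(2\pi)^l\,l!}\prod_{1\le j<k\le l}|e^{i\theta_k}-e^{i\theta_j}|^2,\qquad -\pi<\theta_j<\pi,$$ so that $\tilde D_0=1$; put also $\tilde D_{-1}=0$. Then for every integer $l\ge 0$ $$\Pr\big(L(t,\alpha_+,\alpha_-)\le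 l\big)=e^{-(\alpha_++\alpha_-)t-t^2}\big(\tilde D_l-\alpha_+\alpha_-\,\tilde D_{l-1}\big).$$ -/

import Mathlib

open MeasureTheory ProbabilityTheory
open scoped NNReal Nat unitInterval

noncomputable section

/-- The law of a sample of a Poisson point process on `E` with intensity measure `r • ν`, where
`ν` is a probability measure: the number of points is Poisson distributed with parameter `r`, the
positions are independent with law `ν`, and they are independent of the number of points.
In the pair `(n, x)` the points of the process are `x 0, …, x (n - 1)`. -/
def poissonSampleLaw {E : Type*} [MeasurableSpace E] (r : ℝ≥0) (ν : Measure E)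
    [IsProbabilityMeasure ν] : Measure (ℕ × (ℕ → E)) :=
  (poissonMeasure r).prod (Measure.infinitePi fun _ : ℕ => ν)

/-- The points in the unit square, edges included, given the points inside the square (`bulk`),
the positions `y` of the points `(0, y)` on the edge `x = 0` (`left`), and the positions `x` of
the points `(x, 0)` on the edge `y = 0` (`bottom`). -/
def sourcePoints (bulk : ℕ × (ℕ → I × I)) (left bottom : ℕ × (ℕ → I)) : Set (I × I) :=
  {p | ∃ i < bulk.1, p = bulk.2 i} ∪ {p | ∃ i < left.1, p = (0, left.2 i)} ∪
    {p | ∃ i < bottom.1, p = (bottom.2 i, 0)}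

/-- The maximal number of points of `S` on an up/right path, that is, the maximal cardinality of a
finite subset of `S` which is totally ordered by the coordinatewise order of the square.
(The set of cardinalities is bounded when `S` is finite, as it is for `sourcePoints`.) -/
def longestPath (S : Set (I × I)) : ℕ :=
  sSup {k : ℕ | ∃ s : Finset (I × I), (s : Set (I × I)) ⊆ S ∧
    IsChain (· ≤ ·) (s : Set (I × I)) ∧ s.card = k}

/-- The joint law of the points of the Hammersley process with sources: three independent Poisson
processes, of intensity `t ^ 2` in the unit square, of intensity `αp * t` on the edge `x = 0` and
of intensity `αm * t` on the edge `y = 0`. -/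
def hammersleySourceLaw (t αp αm : ℝ≥0) :
    Measure ((ℕ × (ℕ → I × I)) × (ℕ × (ℕ → I)) × (ℕ × (ℕ → I))) :=
  (poissonSampleLaw (t ^ 2) (volume : Measure (I × I))).prod
    ((poissonSampleLaw (αp * t) (volume : Measure I)).prod
      (poissonSampleLaw (αm * t) (volume : Measure I)))

/-- The average of `f (θ₁, …, θ_l)` over the eigenvalues `exp (i θ_j)` of a Haar distributed
random matrix of `U(l)`, by means of their probability density
`(1 / ((2π)^l l!)) ∏_{j < k} |exp (i θ_k) - exp (i θ_j)|²` on `(-π, π]^l`. -/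
def unitaryAverage (l : ℕ) (f : (Fin l → ℝ) → ℂ) : ℂ :=
  1 / ((2 * Real.pi) ^ l * (l ! : ℂ)) *
    ∫ θ in Set.univ.pi fun _ : Fin l => Set.Ioc (-Real.pi) Real.pi,
      f θ * ∏ j : Fin l, ∏ k ∈ Finset.Ioi j,
        ((‖Complex.exp (Complex.I * θ k) - Complex.exp (Complex.I * θ j)‖ ^ 2 : ℝ) : ℂ)

/-- The average
`⟨∏_j (1 + αp exp (i θ_j)) (1 + αm exp (-i θ_j)) exp (2 t ∑_j cos θ_j)⟩` over `U(l)`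
for `l ≥ 0`, and `0` for `l < 0`. -/
def DTilde (t αp αm : ℝ) : ℤ → ℂ
  | Int.ofNat l => unitaryAverage l fun θ =>
      (∏ j, (1 + αp * Complex.exp (Complex.I * θ j)) *
        (1 + αm * Complex.exp (-(Complex.I * θ j)))) *
      Complex.exp (2 * t * ∑ j, Complex.cos (θ j))
  | Int.negSucc _ => 0

end

/-!
The longest path is computed by patience sorting. The marked points are met in the order of their
ordinates, and the state consists of `l` piles, the end `z i` of the pile `i` being the least
abscissa at which a path of `i + 1` of the points met so far can end. A new point at abscissa `u`
moves the end of the first pile that ends strictly to the right of `u` to `u`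
(`pathsFit_insert_iff`), and the longest path has at most `l` points if and only if each new point
finds such a pile. The points in the square and those on the left edge together form a Poisson
process, whose intensity is the product of `abscissaMeasure`, that is, Lebesgue measure with an atom
at `0`, and of Lebesgue measure. Hence only the volumes of the sets of sequences
`u 0, …, u (N - 1)` of abscissas that survive from a given state `z` are needed.

The exponential generating function of these volumes, as a function of `z`, satisfies the backward
equation: its derivative is the sum over the piles `i` of the integrals over `u` from `z (i - 1)` to
`z i` of its values with `z i` replaced by `u`. This is solved by the determinant of the
coefficients of `w ^ (j - i)` in `exp (X / w) * g (z i)`, where `g x = 1 + w * ∫_{u < x} g u`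
(`sum_integral_slot_coeff_det`, `pi_survives`). Indeed both differentiation with respect to `X` and
integration up to `z i` shift the index of the row `i` by one, while the lower limit `z (i - 1)`
produces a matrix with two equal rows.

The sources on the bottom edge fix the initial state. Integrating their positions, from the last one
to the first, adds to each row a multiple of its shift, which row operations turn into the Toeplitz
matrix of the coefficients of `(1 + b / w) * exp (X / w) * g`. Only for the first source the lower
limit is not the position of another source: there is no source on the atom at the origin, and the
missing term is `a * b` times the minor of size `l - 1` (`sum_integral_bottomState`). This accounts
for the second term of the formula.

At `X = t` the series converge, their values are the Fourier coefficients of the weight of one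
eigenvalue (`hasSum_coeff_edgeSeries`), and by Heine's identity (`unitaryAverage_prod`) the Toeplitz
determinants become averages over the unitary group.
-/

open MeasureTheory ProbabilityTheory
open scoped NNReal Nat unitInterval

noncomputable section

namespace HammersleySources

/-! ### Patience sorting for up/right paths -/

section PatienceSorting

/-- The number of piles of the state `z` whose end lies weakly to the left of `x`. -/
def pileCount {l : ℕ} (z : Fin l → ℝ) (x : ℝ) : ℕ :=
  (Finset.univ.filter fun i => z i ≤ x).card

/-- The piles `z` have been built from the points already met, `z i` being the least abscissa at
which a path of `i + 1` of those points can end, and `S` contains the points still to come.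
`PathsFit z S` says that no up/right path through both kinds of points has more than `l` points:
a path in `S` that starts at abscissa at least `x` can be prolonged backwards by
`pileCount z x` points. -/
def PathsFit {l : ℕ} (z : Fin l → ℝ) (S : Set (I × I)) : Prop :=
  ∀ s : Finset (I × I), (s : Set (I × I)) ⊆ S → IsChain (· ≤ ·) (s : Set (I × I)) →
    ∀ x : ℝ, (∀ p ∈ s, x ≤ p.1) → s.card + pileCount z x ≤ l

/-- A new point at abscissa `u` lands on the pile `i`: this is the first pile that ends strictly
to the right of `u`. -/
def IsSlot {l : ℕ} (z : Fin l → ℝ) (u : ℝ) (i : Fin l) : Prop :=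
  (∀ j < i, z j ≤ u) ∧ u < z i

variable {l : ℕ} {z : Fin l → ℝ} {u x : ℝ} {i : Fin l}

lemma pileCount_le (z : Fin l → ℝ) (x : ℝ) : pileCount z x ≤ l :=
  (Finset.card_filter_le _ _).trans (by simp)

lemma pileCount_mono (z : Fin l → ℝ) {x y : ℝ} (h : x ≤ y) : pileCount z x ≤ pileCount z y :=
  Finset.card_le_card fun i hi => by
    simp only [Finset.mem_filter, Finset.mem_univ, true_and] at hi ⊢
    exact hi.trans h

lemma IsSlot.unique {i j : Fin l} (hi : IsSlot z u i) (hj : IsSlot z u j) : i = j := by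
  rcases lt_trichotomy i j with h | h | h
  · exact absurd (hj.1 i h) (not_le.2 hi.2)
  · exact h
  · exact absurd (hi.1 j h) (not_le.2 hj.2)

lemma exists_isSlot {j : Fin l} (h : u < z j) : ∃ i, IsSlot z u i := by
  induction j using WellFoundedLT.induction with
  | ind j ih =>
    by_cases hj : ∀ k < j, z k ≤ u
    · exact ⟨j, hj, h⟩
    · push Not at hj
      obtain ⟨k, hk, hu⟩ := hj
      exact ih k hk hu

lemma IsSlot.pileCount_eq (hz : Monotone z) (hi : IsSlot z u i) (hux : u ≤ x) (hx : x < z i) :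
    pileCount z x = i := by
  have : (Finset.univ.filter fun k => z k ≤ x) = Finset.Iio i := by
    ext k
    simp only [Finset.mem_filter, Finset.mem_univ, true_and, Finset.mem_Iio]
    refine ⟨fun h => ?_, fun h => (hi.1 k h).trans hux⟩
    by_contra hk
    exact absurd ((hz (not_lt.1 hk)).trans h) (not_le.2 hx)
  rw [pileCount, this, Fin.card_Iio]

lemma IsSlot.pileCount_update_of_le (hz : Monotone z) (hi : IsSlot z u i) (hux : u ≤ x) :
    pileCount (Function.update z i u) x = max (pileCount z x) (i + 1) := by
  by_cases hx : x < z i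
  · have : (Finset.univ.filter fun k => Function.update z i u k ≤ x) = Finset.Iic i := by
      ext k
      simp only [Finset.mem_filter, Finset.mem_univ, true_and, Finset.mem_Iic]
      rcases lt_trichotomy k i with h | h | h
      · simpa [Function.update_of_ne h.ne, h.le] using (hi.1 k h).trans hux
      · simp [h, hux]
      · simp only [Function.update_of_ne h.ne', h.not_ge, iff_false, not_le]
        exact hx.trans_le (hz h.le)
    rw [hi.pileCount_eq hz hux hx, pileCount, this, Fin.card_Iic]
    simp
  · have : (Finset.univ.filter fun k => Function.update z i u k ≤ x) =
        Finset.univ.filter fun k => z k ≤ x := by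
      ext k
      rcases eq_or_ne k i with h | h
      · simp [h, hux, not_lt.1 hx]
      · simp [Function.update_of_ne h]
    have h2 : (i : ℕ) + 1 ≤ pileCount z x := by
      rw [← Fin.card_Iic, pileCount]
      refine Finset.card_le_card fun k hk => ?_
      simp only [Finset.mem_filter, Finset.mem_univ, true_and]
      exact (hz (Finset.mem_Iic.1 hk)).trans (not_lt.1 hx)
    rw [max_eq_left h2, pileCount, this, pileCount]

lemma IsSlot.pileCount_update_of_lt (hi : IsSlot z u i) (hxu : x < u) :
    pileCount (Function.update z i u) x = pileCount z x := by
  have : (Finset.univ.filter fun k => Function.update z i u k ≤ x) =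
      Finset.univ.filter fun k => z k ≤ x := by
    ext k
    rcases eq_or_ne k i with h | h
    · subst h
      simp [hxu.not_ge, (hxu.trans hi.2).not_ge]
    · simp [Function.update_of_ne h]
  rw [pileCount, this, pileCount]

lemma IsSlot.monotone_update (hz : Monotone z) (hi : IsSlot z u i) :
    Monotone (Function.update z i u) := by
  intro j k hjk
  rcases eq_or_ne j i with hj | hj <;> rcases eq_or_ne k i with hk | hk
  · rw [hj, hk]
  · subst hj
    rw [Function.update_self, Function.update_of_ne hk]
    exact hi.2.le.trans (hz hjk)
  · subst hk
    rw [Function.update_self, Function.update_of_ne hj]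
    exact hi.1 j (lt_of_le_of_ne hjk hj)
  · rw [Function.update_of_ne hj, Function.update_of_ne hk]
    exact hz hjk

lemma pathsFit_empty (z : Fin l → ℝ) : PathsFit z ∅ := by
  intro s hs _ x _
  have : s = ∅ := by simpa using hs
  simpa [this] using pileCount_le z x

/-- One step of patience sorting: the lowest point of the configuration is put on its pile. -/
theorem pathsFit_insert_iff (hz : Monotone z) {p : I × I} {S : Set (I × I)}
    (hp : ∀ q ∈ S, p.2 ≤ q.2) (hq : ∀ q ∈ S, ¬ q ≤ p) :
    PathsFit z (insert p S) ↔
      ∃ i, IsSlot z p.1 i ∧ PathsFit (Function.update z i p.1) S := by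
  constructor
  · intro h
    have h1 := h {p} (by simp) (by simp) p.1 (by simp)
    obtain ⟨j, hj⟩ : ∃ j, (p.1 : ℝ) < z j := by
      by_contra! hcon
      have : pileCount z (p.1 : ℝ) = l := by
        simp [pileCount, Finset.filter_true_of_mem (fun i _ => hcon i)]
      simp [this] at h1
    obtain ⟨i, hi⟩ := exists_isSlot hj
    refine ⟨i, hi, fun s hs hc x hx => ?_⟩
    have h2 := h s (hs.trans (Set.subset_insert _ _)) hc x hx
    rcases lt_or_ge x p.1 with hxu | hux
    · rwa [hi.pileCount_update_of_lt hxu]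
    · rw [hi.pileCount_update_of_le hz hux]
      have hps : p ∉ s := fun hmem => hq p (hs hmem) le_rfl
      have h3 := h (insert p s) (by
          rw [Finset.coe_insert]; exact Set.insert_subset_insert hs) (by
          rw [Finset.coe_insert]
          refine hc.insert fun q hqs _ => Or.inl ⟨?_, hp q (hs hqs)⟩
          exact_mod_cast hux.trans (hx q hqs)) p.1 (by
          intro q hqs
          rcases Finset.mem_insert.1 hqs with rfl | hqs
          · rfl
          · exact hux.trans (hx q hqs))
      rw [Finset.card_insert_of_notMem hps, hi.pileCount_eq hz le_rfl hi.2] at h3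
      omega
  · rintro ⟨i, hi, h⟩ s hs hc x hx
    by_cases hps : p ∈ s
    · have hle : ∀ q ∈ s.erase p, p ≤ q := fun q hqs => by
        have hqs' := Finset.mem_erase.1 hqs
        have hqS : q ∈ S := (hs hqs'.2).resolve_left hqs'.1
        exact (hc hps hqs'.2 (Ne.symm hqs'.1)).resolve_right (hq q hqS)
      have h1 := h (s.erase p) (fun q hqs => by
          have hqs' := Finset.mem_erase.1 (Finset.mem_coe.1 hqs)
          exact (hs hqs'.2).resolve_left hqs'.1)
        (hc.mono (by simp)) p.1 (fun q hqs => by exact_mod_cast (hle q hqs).1)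
      rw [hi.pileCount_update_of_le hz le_rfl, Finset.card_erase_of_mem hps] at h1
      have h2 := pileCount_mono z (hx p hps)
      rw [hi.pileCount_eq hz le_rfl hi.2] at h2
      have := Finset.card_pos.2 ⟨p, hps⟩
      omega
    · have h1 := h s (fun q hqs => (hs hqs).resolve_left fun hh => hps (hh ▸ hqs)) hc x hx
      rcases lt_or_ge x p.1 with hxu | hux
      · rwa [hi.pileCount_update_of_lt hxu] at h1
      · rw [hi.pileCount_update_of_le hz hux] at h1
        omega

lemma longestPath_le_iff_forall {S : Set (I × I)} (hS : S.Finite) (l : ℕ) :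
    longestPath S ≤ l ↔ ∀ s : Finset (I × I), (s : Set (I × I)) ⊆ S →
      IsChain (· ≤ ·) (s : Set (I × I)) → s.card ≤ l := by
  have hbdd : BddAbove {k : ℕ | ∃ s : Finset (I × I), (s : Set (I × I)) ⊆ S ∧
      IsChain (· ≤ ·) (s : Set (I × I)) ∧ s.card = k} := by
    refine ⟨S.ncard, ?_⟩
    rintro k ⟨s, hs, -, rfl⟩
    rw [← Set.ncard_coe_finset]
    exact Set.ncard_le_ncard hs hS
  rw [longestPath, csSup_le_iff hbdd ⟨0, ∅, by simp, by simp, rfl⟩]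
  exact ⟨fun h s hs hc => h _ ⟨s, hs, hc, rfl⟩, fun h _ ⟨s, hs, hc, hk⟩ => hk ▸ h s hs hc⟩

/-- Before any point is met all piles are absent; an absent pile ends at `2`, to the right of the
whole square. -/
theorem longestPath_le_iff {S : Set (I × I)} (hS : S.Finite) (l : ℕ) :
    longestPath S ≤ l ↔ PathsFit (fun _ : Fin l => 2) S := by
  rw [longestPath_le_iff_forall hS]
  constructor
  · intro h s hs hc x hx
    rcases s.eq_empty_or_nonempty with rfl | ⟨p, hp⟩
    · simpa using pileCount_le _ x
    · have hx2 : ¬ (2 : ℝ) ≤ x := by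
        have := hx p hp
        have := p.1.2.2
        linarith
      have : pileCount (fun _ : Fin l => 2) x = 0 := by simp [pileCount, hx2]
      rw [this]
      exact h s hs hc
  · intro h s hs hc
    exact (Nat.le_add_right _ _).trans (h s hs hc 0 fun p _ => p.1.2.1)

/-- The points with abscissas `u 0, u 1, …`, met in this order, can all be put on one of the `l`
piles. -/
def Survives {l : ℕ} : (N : ℕ) → (Fin l → ℝ) → (Fin N → I) → Prop
  | 0, _, _ => True
  | N + 1, z, u => ∃ i, IsSlot z (u 0) i ∧
      Survives N (Function.update z i (u 0)) (Fin.tail u)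

theorem pathsFit_range_iff {N : ℕ} (hz : Monotone z) (p : Fin N → I × I)
    (hp : StrictMono fun k => (p k).2) :
    PathsFit z (Set.range p) ↔ Survives N z (fun k => (p k).1) := by
  induction N generalizing z with
  | zero => simpa [Survives] using pathsFit_empty z
  | succ N ih =>
    have hr : Set.range p = insert (p 0) (Set.range (Fin.tail p)) := by
      rw [← Fin.range_cons, Fin.cons_self_tail]
    have hlt : ∀ q ∈ Set.range (Fin.tail p), (p 0).2 < q.2 := by
      rintro _ ⟨k, rfl⟩
      exact hp (Fin.succ_pos k)
    rw [hr, pathsFit_insert_iff hz (fun q hq => (hlt q hq).le)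
      (fun q hq h => absurd h.2 (not_le.2 (hlt q hq))), Survives]
    refine exists_congr fun i => and_congr_right fun hi => ?_
    exact ih (hi.monotone_update hz) (Fin.tail p) (fun a b hab => hp (Fin.succ_lt_succ_iff.2 hab))

/-- The state of the piles after the points of abscissas `x 0 < x 1 < … < x (b - 1)` on the bottom
edge. -/
def bottomState (l : ℕ) {b : ℕ} (x : Fin b → I) : Fin l → ℝ :=
  fun i => if h : (i : ℕ) < b then x ⟨i, h⟩ else 2

lemma monotone_bottomState (l : ℕ) {b : ℕ} {x : Fin b → I} (hx : StrictMono x) :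
    Monotone (bottomState l x) := by
  intro i j hij
  unfold bottomState
  by_cases hj : (j : ℕ) < b
  · have hi : (i : ℕ) < b := lt_of_le_of_lt hij hj
    simp only [hi, hj, dif_pos]
    exact_mod_cast hx.monotone (show (⟨i, hi⟩ : Fin b) ≤ ⟨j, hj⟩ from hij)
  · simp only [hj, dif_neg, not_false_eq_true]
    split_ifs with hi
    · linarith [(x ⟨i, hi⟩).2.2]
    · rfl

/-- A path of bottom points can always be put in front of a path in the rest of the configuration
that starts further to the right. -/
theorem pathsFit_bottom_union_iff {b : ℕ} {x : Fin b → I} (hx : StrictMono x)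
    {S : Set (I × I)} (hS : ∀ q ∈ S, 0 < q.2) :
    PathsFit (fun _ : Fin l => 2) (S ∪ Set.range fun k => (x k, (0 : I))) ↔
      b ≤ l ∧ PathsFit (bottomState l x) S := by
  -- The bottom points are put on their piles one after the other, from left to right.
  have key : ∀ i (hi : i ≤ b), PathsFit (fun _ : Fin l => 2)
      (S ∪ Set.range fun k => (x k, (0 : I))) ↔ i ≤ l ∧
        PathsFit (bottomState l fun k : Fin i => x (k.castLE hi))
          (S ∪ (fun k => (x k, (0 : I))) '' {k : Fin b | i ≤ (k : ℕ)}) := by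
    intro i
    induction i with
    | zero =>
      intro hi
      have : bottomState l (fun k : Fin 0 => x (k.castLE hi)) = fun _ => 2 := by
        ext i; simp [bottomState]
      simp [this]
    | succ i ih =>
      intro hi
      set y : Fin i → I := fun k => x (k.castLE (Nat.le_of_succ_le hi)) with hy
      have hyx : StrictMono y := fun a c hac => hx (by simpa using hac)
      have hset : S ∪ (fun k => (x k, (0 : I))) '' {k : Fin b | i ≤ (k : ℕ)} =
          insert (x ⟨i, hi⟩, (0 : I))
            (S ∪ (fun k => (x k, (0 : I))) '' {k : Fin b | i + 1 ≤ (k : ℕ)}) := by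
        have : {k : Fin b | i ≤ (k : ℕ)} = insert ⟨i, hi⟩ {k : Fin b | i + 1 ≤ (k : ℕ)} := by
          ext k
          simp only [Set.mem_ofPred_eq, Set.mem_insert_iff, Fin.ext_iff]
          omega
        rw [this, Set.image_insert_eq, Set.union_insert]
      rw [ih (Nat.le_of_succ_le hi), hset, pathsFit_insert_iff (monotone_bottomState l hyx)
        (fun q _ => q.2.2.1)]
      · have hslot : ∀ k : Fin l,
            IsSlot (bottomState l y) (x ⟨i, hi⟩) k ↔ (k : ℕ) = i := by
          have hlt : ∀ k : Fin l, (k : ℕ) < i → bottomState l y k ≤ x ⟨i, hi⟩ := fun k hk => by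
            simp only [bottomState, hk, dif_pos, hy]
            exact_mod_cast hx.monotone (by simpa [Fin.le_def] using hk.le)
          have hge : ∀ k : Fin l, i ≤ (k : ℕ) → x ⟨i, hi⟩ < bottomState l y k := fun k hk => by
            simp only [bottomState, hk.not_gt, dif_neg, not_false_eq_true]
            linarith [(x ⟨i, hi⟩).2.2]
          intro k
          constructor
          · rintro ⟨h1, h2⟩
            by_contra hne
            rcases lt_or_gt_of_ne hne with h | h
            · exact absurd (hlt k h) (not_le.2 h2)
            · exact absurd (h1 ⟨i, h.trans k.2⟩ h) (not_le.2 (hge _ le_rfl))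
          · intro h
            exact ⟨fun j hj => hlt j (h ▸ hj), hge k h.ge⟩
        have hupd : ∀ k : Fin l, (k : ℕ) = i →
            Function.update (bottomState l y) k (x ⟨i, hi⟩ : ℝ) =
              bottomState l fun k : Fin (i + 1) => x (k.castLE hi) := by
          intro k hk
          ext j
          rcases eq_or_ne j k with rfl | hj
          · simp [bottomState, hk]
          · have hj' : (j : ℕ) ≠ i := fun h => hj (Fin.ext (h.trans hk.symm))
            rw [Function.update_of_ne hj]
            have : (j : ℕ) < i ↔ (j : ℕ) < i + 1 := by omega
            simp only [bottomState, this, hy, Fin.castLE_mk]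
        constructor
        · rintro ⟨-, k, hk, h⟩
          rw [hslot] at hk
          rw [hupd k hk] at h
          exact ⟨by have := k.2; omega, h⟩
        · rintro ⟨hil, h⟩
          refine ⟨by omega, ⟨i, hil⟩, (hslot _).2 rfl, ?_⟩
          rwa [hupd _ rfl]
      · rintro q (hq | ⟨k, hk, rfl⟩) hle
        · exact absurd hle.2 (not_le.2 (hS q hq))
        · exact absurd (show x k ≤ x ⟨i, hi⟩ from hle.1) (not_le.2 (hx hk))
  have := key b le_rfl
  simpa [Set.ofPred_false, fun k : Fin b => k.2.not_ge] using this

end PatienceSorting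

/-! ### The coefficients of the stochastic exponential of the horizontal intensity -/

/-- The coefficient of `w ^ n` in `exp (y * w)`, for an integer `n`. -/
def expCoeff : ℤ → ℝ → ℝ
  | Int.ofNat n, y => y ^ n / n !
  | Int.negSucc _, _ => 0

/-- The intensity of the points of a horizontal strip as a function of the abscissa: Lebesgue
measure with weight `t` together with an atom of mass `a`, which carries the sources on the left
edge. -/
def abscissaMeasure (t a : ℝ≥0) : Measure I :=
  t • volume + a • Measure.dirac 0

instance (t a : ℝ≥0) : IsFiniteMeasure (abscissaMeasure t a) := by
  unfold abscissaMeasure; infer_instance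

/-- The coefficient of `w ^ n` in the solution `g` of `g x = 1 + w * ∫_{u < x} g u`, the integral
being taken with respect to `abscissaMeasure t a`. The solution is
`(1 + a * w) * exp (t * w * min x 1)` for `x > 0`, and `1` for `x ≤ 0`. -/
def sourceCoeff (t a : ℝ) (n : ℤ) (x : ℝ) : ℝ :=
  if x ≤ 0 then expCoeff n 0
  else expCoeff n (t * min x 1) + a * expCoeff (n - 1) (t * min x 1)

lemma expCoeff_of_neg {n : ℤ} (hn : n < 0) (y : ℝ) : expCoeff n y = 0 := by
  cases n with
  | ofNat n => exact absurd hn (by simp)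
  | negSucc n => rfl

lemma expCoeff_natCast (n : ℕ) (y : ℝ) : expCoeff n y = y ^ n / n ! := rfl

@[simp] lemma expCoeff_zero_left (y : ℝ) : expCoeff 0 y = 1 := by
  have := expCoeff_natCast 0 y
  simpa using this

lemma expCoeff_zero_right {n : ℤ} (hn : n ≠ 0) : expCoeff n 0 = 0 := by
  rcases lt_or_gt_of_ne hn with h | h
  · exact expCoeff_of_neg h 0
  · lift n to ℕ using h.le
    rw [expCoeff_natCast, zero_pow (by exact_mod_cast hn), zero_div]

lemma hasDerivAt_expCoeff (n : ℤ) (y : ℝ) : HasDerivAt (expCoeff (n + 1)) (expCoeff n y) y := by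
  rcases lt_trichotomy n (-1) with h | h | h
  · have : expCoeff (n + 1) = fun _ => 0 := by ext y; exact expCoeff_of_neg (by omega) y
    rw [this, expCoeff_of_neg (by omega)]
    exact hasDerivAt_const _ _
  · subst h
    have : expCoeff (-1 + 1) = fun _ => 1 := by ext y; simp
    rw [this, expCoeff_of_neg (by omega)]
    exact hasDerivAt_const _ _
  · lift n to ℕ using by omega
    have : expCoeff ((n : ℤ) + 1) = fun y : ℝ => y ^ (n + 1) / ((n + 1)! : ℕ) := by
      ext y; exact expCoeff_natCast (n + 1) y
    rw [this, expCoeff_natCast]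
    refine ((hasDerivAt_pow (n + 1) y).div_const _).congr_deriv ?_
    rw [Nat.factorial_succ]
    push_cast
    field_simp

lemma continuous_expCoeff (n : ℤ) : Continuous (expCoeff n) := by
  have := fun y => (hasDerivAt_expCoeff (n - 1) y).continuousAt
  rw [sub_add_cancel] at this
  exact continuous_iff_continuousAt.2 this

lemma sourceCoeff_of_neg (t a : ℝ) {n : ℤ} (hn : n < 0) (x : ℝ) : sourceCoeff t a n x = 0 := by
  simp [sourceCoeff, expCoeff_of_neg hn, expCoeff_of_neg (show n - 1 < 0 by omega)]

@[simp] lemma sourceCoeff_zero_left (t a x : ℝ) : sourceCoeff t a 0 x = 1 := by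
  simp [sourceCoeff, expCoeff_of_neg (show (-1 : ℤ) < 0 by omega)]

lemma sourceCoeff_zero_right (t a : ℝ) (n : ℤ) : sourceCoeff t a n 0 = expCoeff n 0 := by
  simp [sourceCoeff]

lemma measurable_sourceCoeff (t a : ℝ) (n : ℤ) : Measurable (sourceCoeff t a n) := by
  unfold sourceCoeff
  refine Measurable.ite measurableSet_Iic measurable_const (Continuous.measurable ?_)
  have h1 := continuous_expCoeff n
  have h2 := continuous_expCoeff (n - 1)
  fun_prop

lemma exists_abs_sourceCoeff_le (t a : ℝ) (n : ℤ) : ∃ C, ∀ x, |sourceCoeff t a n x| ≤ C := by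
  have hc : Continuous fun y => expCoeff n (t * y) + a * expCoeff (n - 1) (t * y) := by
    have h1 := continuous_expCoeff n
    have h2 := continuous_expCoeff (n - 1)
    fun_prop
  obtain ⟨C, hC⟩ := (isCompact_Icc (a := (0 : ℝ)) (b := 1)).exists_bound_of_continuousOn
    hc.continuousOn
  refine ⟨max C |expCoeff n 0|, fun x => ?_⟩
  unfold sourceCoeff
  split_ifs with h
  · exact le_max_right _ _
  · exact le_max_of_le_left (hC (min x 1) ⟨le_min (not_le.1 h).le zero_le_one, min_le_right _ _⟩)

lemma integrable_sourceCoeff (t a : ℝ) (n : ℤ) (μ : Measure I) [IsFiniteMeasure μ] :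
    Integrable (fun u : I => sourceCoeff t a n u) μ := by
  obtain ⟨C, hC⟩ := exists_abs_sourceCoeff_le t a n
  exact Integrable.of_bound
    ((measurable_sourceCoeff t a n).comp measurable_subtype_coe).aestronglyMeasurable C
    (Filter.Eventually.of_forall fun u => hC u)

lemma setIntegral_unitInterval_lt (f : ℝ → ℝ) {b : ℝ} (hb : 0 < b) :
    ∫ u in {u : I | (u : ℝ) < b}, f u = ∫ x in (0 : ℝ)..min b 1, f x := by
  have h1 : ∫ u in {u : I | (u : ℝ) < b}, f u = ∫ u : I, (Set.Iio b).indicator f u := by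
    rw [← integral_indicator (measurableSet_lt measurable_subtype_coe measurable_const)]
    rfl
  have h2 : ∫ u : I, (Set.Iio b).indicator f u =
      ∫ x in Set.Icc (0 : ℝ) 1, (Set.Iio b).indicator f x :=
    integral_subtype_comap measurableSet_Icc _
  rw [h1, h2, setIntegral_indicator measurableSet_Iio, intervalIntegral.integral_of_le
    (le_min hb.le zero_le_one), ← integral_Icc_eq_integral_Ioc]
  refine setIntegral_congr_set ?_
  rcases lt_or_ge 1 b with h | h
  · rw [min_eq_right h.le, Set.inter_eq_left.2 fun x hx => hx.2.trans_lt h]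
    exact Filter.EventuallyEq.rfl
  · rw [min_eq_left h]
    have : Set.Icc (0 : ℝ) 1 ∩ Set.Iio b = Set.Ico 0 b := by
      ext x
      simp only [Set.mem_inter_iff, Set.mem_Icc, Set.mem_Iio, Set.mem_Ico]
      exact ⟨fun h => ⟨h.1.1, h.2⟩, fun h' => ⟨⟨h'.1, by linarith [h'.2]⟩, h'.2⟩⟩
    rw [this]
    exact Ico_ae_eq_Icc

lemma integral_sourceCoeff_volume_lt (t a : ℝ) (n : ℤ) {b : ℝ} (hb : 0 < b) :
    t * ∫ u in {u : I | (u : ℝ) < b}, sourceCoeff t a n u =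
      sourceCoeff t a (n + 1) b - (expCoeff (n + 1) 0 + a * expCoeff n 0) := by
  rw [setIntegral_unitInterval_lt _ hb, ← intervalIntegral.integral_const_mul]
  have hb' : 0 ≤ min b 1 := le_min hb.le zero_le_one
  have h1 : ∫ x in (0 : ℝ)..min b 1, t * sourceCoeff t a n x =
      ∫ x in (0 : ℝ)..min b 1,
        t * (expCoeff n (t * x) + a * expCoeff (n - 1) (t * x)) := by
    refine intervalIntegral.integral_congr_uIoo fun x hx => ?_
    rw [Set.uIoo_of_le hb'] at hx
    have hx1 : x ≤ 1 := hx.2.le.trans (min_le_right _ _)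
    simp only [sourceCoeff, not_le.2 hx.1, if_false, min_eq_left hx1]
  rw [h1, intervalIntegral.integral_eq_sub_of_hasDerivAt
    (f := fun x => expCoeff (n + 1) (t * x) + a * expCoeff n (t * x))]
  · simp [sourceCoeff, not_le.2 hb]
  · intro x _
    have hlin : HasDerivAt (fun x : ℝ => t * x) t x := by
      simpa using (hasDerivAt_id x).const_mul t
    have e1 := (hasDerivAt_expCoeff n (t * x)).comp x hlin
    have e2 := (hasDerivAt_expCoeff (n - 1) (t * x)).comp x hlin
    rw [sub_add_cancel] at e2
    refine (e1.add (e2.const_mul a)).congr_deriv ?_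
    ring
  · have h1 := continuous_expCoeff n
    have h2 := continuous_expCoeff (n - 1)
    exact Continuous.intervalIntegrable (by fun_prop) _ _

lemma integral_sourceCoeff_lt (t a : ℝ≥0) (n : ℤ) (b : ℝ) :
    ∫ u in {u : I | (u : ℝ) < b}, sourceCoeff t a n u ∂abscissaMeasure t a =
      sourceCoeff t a (n + 1) b - sourceCoeff t a (n + 1) 0 := by
  rcases le_or_gt b 0 with hb | hb
  · have : {u : I | (u : ℝ) < b} = ∅ := by
      ext u
      simpa using hb.trans u.2.1
    simp [this, sourceCoeff, hb]
  · have hms : MeasurableSet {u : I | (u : ℝ) < b} :=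
      measurableSet_lt measurable_subtype_coe measurable_const
    rw [abscissaMeasure, Measure.restrict_add, Measure.restrict_smul, Measure.restrict_smul,
      integral_add_measure (integrable_sourceCoeff _ _ _ _) (integrable_sourceCoeff _ _ _ _),
      integral_smul_nnreal_measure, integral_smul_nnreal_measure,
      setIntegral_dirac' (by
        exact ((measurable_sourceCoeff t a n).comp measurable_subtype_coe).stronglyMeasurable)
        _ hms]
    have h0 : (0 : I) ∈ {u : I | (u : ℝ) < b} := by simpa using hb
    rw [if_pos h0, NNReal.smul_def, NNReal.smul_def, smul_eq_mul, smul_eq_mul,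
      integral_sourceCoeff_volume_lt _ _ _ hb]
    rw [show ((0 : I) : ℝ) = 0 from rfl, sourceCoeff_zero_right, sourceCoeff_zero_right]
    ring

lemma integral_sourceCoeff_Ico (t a : ℝ≥0) (n : ℤ) {x b : ℝ} (h : x ≤ b) :
    ∫ u in {u : I | x ≤ (u : ℝ) ∧ (u : ℝ) < b}, sourceCoeff t a n u ∂abscissaMeasure t a =
      sourceCoeff t a (n + 1) b - sourceCoeff t a (n + 1) x := by
  have : {u : I | x ≤ (u : ℝ) ∧ (u : ℝ) < b} = {u : I | (u : ℝ) < b} \ {u : I | (u : ℝ) < x} := by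
    ext u; simp [and_comm]
  have h2 := setIntegral_sdiff (t := {u : I | (u : ℝ) < x}) (s := {u : I | (u : ℝ) < b})
    (measurableSet_lt measurable_subtype_coe measurable_const)
    (integrable_sourceCoeff t a n (abscissaMeasure t a)).integrableOn
    (fun u (hu : (u : ℝ) < x) => lt_of_lt_of_le hu h)
  rw [this, h2, integral_sourceCoeff_lt, integral_sourceCoeff_lt]
  ring

lemma integral_sourceCoeff_volume (t a : ℝ) (n : ℤ) :
    t * ∫ u : I, sourceCoeff t a n u =
      sourceCoeff t a (n + 1) 2 - (expCoeff (n + 1) 0 + a * expCoeff n 0) := by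
  rw [← integral_sourceCoeff_volume_lt t a n two_pos]
  congr 1
  have : {u : I | (u : ℝ) < 2} = Set.univ := by
    ext u
    simpa using u.2.2.trans_lt one_lt_two
  rw [this, setIntegral_univ]

lemma integral_sourceCoeff_volume_gt (t a : ℝ) (n : ℤ) {x : I} (hx : 0 < x) :
    t * ∫ u in Set.Ioi x, sourceCoeff t a n u =
      sourceCoeff t a (n + 1) 2 - sourceCoeff t a (n + 1) x := by
  have hset : Set.Ici x = {u : I | (u : ℝ) < x}ᶜ := by
    ext u; simp
  have h2 := setIntegral_compl (s := {u : I | (u : ℝ) < x})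
    (measurableSet_lt measurable_subtype_coe measurable_const)
    (integrable_sourceCoeff t a n volume)
  rw [← integral_Ici_eq_integral_Ioi, hset, h2, mul_sub, integral_sourceCoeff_volume,
    integral_sourceCoeff_volume_lt _ _ _ (show (0 : ℝ) < x from hx)]
  ring

/-! ### Determinants of power series -/

section Determinant

open PowerSeries

variable {l : ℕ}

lemma _root_.Derivation.map_finset_prod {R A : Type*} [CommRing R] [CommRing A] [Algebra R A]
    {ι : Type*} [DecidableEq ι] (D : Derivation R A A) (s : Finset ι) (f : ι → A) :
    D (∏ i ∈ s, f i) = ∑ i ∈ s, D (f i) * ∏ j ∈ s.erase i, f j := by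
  induction s using Finset.induction_on with
  | empty => simp
  | insert a s ha ih =>
    rw [Finset.prod_insert ha, D.leibniz, ih, Finset.sum_insert ha, Finset.erase_insert ha,
      smul_eq_mul, smul_eq_mul, Finset.mul_sum, add_comm, mul_comm (∏ i ∈ s, f i)]
    congr 1
    refine Finset.sum_congr rfl fun i hi => ?_
    have hia : i ≠ a := fun h => ha (h ▸ hi)
    rw [Finset.erase_insert_of_ne hia.symm,
      Finset.prod_insert (fun h => ha (Finset.mem_of_mem_erase h))]
    ring

lemma _root_.Derivation.map_det {R A : Type*} [CommRing R] [CommRing A] [Algebra R A]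
    {n : Type*} [Fintype n] [DecidableEq n] (D : Derivation R A A) (M : Matrix n n A) :
    D M.det = ∑ i, (M.updateRow i fun j => D (M i j)).det := by
  have h : ∀ B : Matrix n n A, B.det = ∑ e : Equiv.Perm n, e.sign • ∏ i, B i (e i) := fun B => by
    rw [← Matrix.det_transpose, Matrix.det_apply]; rfl
  simp_rw [h]
  rw [map_sum, Finset.sum_comm]
  refine Finset.sum_congr rfl fun e _ => ?_
  rw [← Finset.smul_sum, Units.smul_def, Units.smul_def, map_zsmul, D.map_finset_prod]
  congr 1
  refine Finset.sum_congr rfl fun i _ => ?_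
  rw [← Finset.mul_prod_erase _ _ (Finset.mem_univ i), Matrix.updateRow_self]
  congr 1
  refine Finset.prod_congr rfl fun j hj => ?_
  rw [Matrix.updateRow_ne (Finset.ne_of_mem_erase hj)]

/-- A determinant of power series can be integrated coefficientwise along one row. -/
lemma integral_coeff_det_updateRow {X : Type*} [MeasurableSpace X] {μ : Measure X}
    (M : Matrix (Fin l) (Fin l) ℝ⟦X⟧) (i : Fin l) (v : X → Fin l → ℝ⟦X⟧)
    (hv : ∀ j k, Integrable (fun u => coeff k (v u j)) μ) (N : ℕ) :
    Integrable (fun u => coeff N (M.updateRow i (v u)).det) μ ∧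
      ∫ u, coeff N (M.updateRow i (v u)).det ∂μ =
        coeff N (M.updateRow i fun j => PowerSeries.mk fun k => ∫ u, coeff k (v u j) ∂μ).det := by
  have key : ∀ w : Fin l → ℝ⟦X⟧, coeff N (M.updateRow i w).det =
      ∑ j, ∑ p ∈ Finset.HasAntidiagonal.antidiagonal N, coeff p.1 (w j) *
        coeff p.2 (M.updateRow i fun k => if j = k then 1 else 0).det := by
    intro w
    have := LinearMap.pi_apply_eq_sum_univ
      ((LinearMap.proj i).comp (Matrix.cramer M.transpose)) w
    simp only [LinearMap.comp_apply, LinearMap.proj_apply, Matrix.cramer_transpose_apply,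
      smul_eq_mul] at this
    rw [this, map_sum]
    simp_rw [coeff_mul]
  have hint : ∀ j, ∀ p ∈ Finset.HasAntidiagonal.antidiagonal N,
      Integrable (fun u => coeff p.1 (v u j) *
        coeff p.2 (M.updateRow i fun k => if j = k then 1 else 0).det) μ :=
    fun j p _ => (hv j p.1).mul_const _
  simp_rw [key]
  refine ⟨integrable_finsetSum _ fun j _ => integrable_finsetSum _ (hint j), ?_⟩
  rw [integral_finsetSum _ fun j _ => integrable_finsetSum _ (hint j)]
  refine Finset.sum_congr rfl fun j _ => ?_
  rw [integral_finsetSum _ (hint j)]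
  refine Finset.sum_congr rfl fun p _ => ?_
  rw [integral_mul_const, coeff_mk]

lemma _root_.Matrix.det_updateRow_sub {R n : Type*} [CommRing R] [Fintype n] [DecidableEq n]
    (M : Matrix n n R) (i : n) (v w : n → R) :
    (M.updateRow i fun j => v j - w j).det = (M.updateRow i v).det - (M.updateRow i w).det := by
  rw [← Matrix.cramer_transpose_apply, ← Matrix.cramer_transpose_apply,
    ← Matrix.cramer_transpose_apply, ← Pi.sub_apply, ← map_sub]
  rfl

/-! ### The determinantal solution of the backward equation -/

/-- The coefficient of `w ^ d` in `exp (X / w) * g x`, where `g x` is the generating function of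
the numbers `sourceCoeff t a n x`. -/
def sourceSeries (t a : ℝ) (d : ℤ) (x : ℝ) : ℝ⟦X⟧ :=
  PowerSeries.mk fun k => sourceCoeff t a (k + d) x / k !

/-- The matrix whose determinant is the exponential generating function of the volumes of the
point sequences that can be put on the piles `z`. -/
def stateMatrix (t a : ℝ) (z : Fin l → ℝ) : Matrix (Fin l) (Fin l) ℝ⟦X⟧ :=
  Matrix.of fun i j => sourceSeries t a ((j : ℤ) - i) (z i)

lemma derivative_sourceSeries (t a : ℝ) (d : ℤ) (x : ℝ) :
    derivative ℝ (sourceSeries t a d x) = sourceSeries t a (d + 1) x := by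
  ext k
  rw [coeff_derivative, sourceSeries, sourceSeries, coeff_mk, coeff_mk, Nat.factorial_succ]
  push_cast
  rw [show (k : ℤ) + 1 + d = k + (d + 1) by ring]
  field_simp

lemma stateMatrix_update (t a : ℝ) (z : Fin l → ℝ) (i : Fin l) (u : ℝ) :
    stateMatrix t a (Function.update z i u) =
      (stateMatrix t a z).updateRow i fun j => sourceSeries t a ((j : ℤ) - i) u := by
  ext1 k j
  rcases eq_or_ne k i with rfl | h
  · simp [stateMatrix]
  · simp [stateMatrix, Matrix.updateRow_ne h, Function.update_of_ne h]

lemma constantCoeff_det_stateMatrix (t a : ℝ) (z : Fin l → ℝ) :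
    constantCoeff (stateMatrix t a z).det = 1 := by
  rw [RingHom.map_det, Matrix.det_of_isUpperTriangular]
  · refine Finset.prod_eq_one fun i _ => ?_
    simp [stateMatrix, sourceSeries]
  · intro i j hij
    have : ((j : ℤ) - i) < 0 := by
      have : (j : ℕ) < i := hij
      omega
    simp [stateMatrix, sourceSeries, sourceCoeff_of_neg _ _ this]

/-- The right end of the pile before the pile `i`; before the first pile there is the left edge. -/
def prevEnd (z : Fin l → ℝ) (i : Fin l) : ℝ :=
  if 0 < (i : ℕ) then z ⟨i - 1, by omega⟩ else 0

lemma isSlot_iff {z : Fin l → ℝ} (hz : Monotone z) (u : I) (i : Fin l) :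
    IsSlot z u i ↔ prevEnd z i ≤ u ∧ (u : ℝ) < z i := by
  unfold IsSlot prevEnd
  refine and_congr_left fun _ => ?_
  split_ifs with h
  · constructor
    · exact fun hs => hs _ (by rw [Fin.lt_def]; simp only; omega)
    · intro hs j hj
      refine (hz ?_).trans hs
      rw [Fin.le_def]
      rw [Fin.lt_def] at hj
      simp only
      omega
  · refine iff_of_true (fun j hj => ?_) u.2.1
    rw [Fin.lt_def] at hj
    omega

lemma prevEnd_le {z : Fin l → ℝ} (hz : Monotone z) (h0 : ∀ i, 0 ≤ z i) (i : Fin l) :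
    prevEnd z i ≤ z i := by
  unfold prevEnd
  split_ifs with h
  · exact hz (by rw [Fin.le_def]; simp only; omega)
  · exact h0 i

/-- The boundary terms at the lower ends of the slots vanish, since they repeat the preceding
row. -/
lemma det_updateRow_prevEnd (t a : ℝ) (z : Fin l → ℝ) (i : Fin l) :
    ((stateMatrix t a z).updateRow i fun j =>
      sourceSeries t a ((j : ℤ) - i + 1) (prevEnd z i)).det = 0 := by
  by_cases h : 0 < (i : ℕ)
  · have hne : (⟨(i : ℕ) - 1, by omega⟩ : Fin l) ≠ i := by
      rw [Ne, Fin.ext_iff]; simp only; omega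
    refine Matrix.det_zero_of_row_eq hne ?_
    rw [Matrix.updateRow_self, Matrix.updateRow_ne hne]
    ext1 j
    simp only [stateMatrix, Matrix.of_apply, prevEnd, h, if_true]
    congr 1
    push_cast [Nat.cast_sub (show 1 ≤ (i : ℕ) from h)]
    ring
  · refine Matrix.det_eq_zero_of_row_eq_zero i fun j => ?_
    rw [Matrix.updateRow_self]
    ext k
    have hi : (i : ℕ) = 0 := by omega
    have hp : prevEnd z i = 0 := if_neg h
    rw [hp, hi, sourceSeries, coeff_mk, sourceCoeff_zero_right]
    rw [expCoeff_zero_right (by omega)]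
    simp

lemma integrable_coeff_sourceSeries (t a : ℝ) (d : ℤ) (k : ℕ) (μ : Measure I)
    [IsFiniteMeasure μ] : Integrable (fun u : I => coeff k (sourceSeries t a d u)) μ := by
  simp only [sourceSeries, coeff_mk]
  exact (integrable_sourceCoeff t a _ μ).div_const _

lemma integrable_coeff_det_update (t a : ℝ) (z : Fin l → ℝ) (i : Fin l) (N : ℕ) (μ : Measure I)
    [IsFiniteMeasure μ] :
    Integrable (fun u : I => coeff N (stateMatrix t a (Function.update z i u)).det) μ := by
  simp_rw [stateMatrix_update]
  exact (integral_coeff_det_updateRow _ i (fun (u : I) j => sourceSeries t a ((j : ℤ) - i) u)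
    (fun j k => integrable_coeff_sourceSeries t a _ k μ) N).1

/-- The determinant of `stateMatrix` solves the backward equation of patience sorting. -/
theorem sum_integral_slot_coeff_det (t a : ℝ≥0) {z : Fin l → ℝ} (hz : Monotone z)
    (h0 : ∀ i, 0 ≤ z i) (N : ℕ) :
    ∑ i, ∫ u in {u : I | IsSlot z u i},
        coeff N (stateMatrix t a (Function.update z i u)).det ∂abscissaMeasure t a =
      coeff (N + 1) (stateMatrix t a z).det * (N + 1) := by
  rw [← coeff_derivative, Derivation.map_det, map_sum]
  refine Finset.sum_congr rfl fun i _ => ?_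
  have hset : {u : I | IsSlot z u i} = {u : I | prevEnd z i ≤ u ∧ (u : ℝ) < z i} := by
    ext u; exact isSlot_iff hz u i
  simp_rw [stateMatrix_update]
  rw [hset, (integral_coeff_det_updateRow _ i
    (fun (u : I) j => sourceSeries t a ((j : ℤ) - i) u)
    (fun j k => integrable_coeff_sourceSeries t a _ k _) N).2]
  have hrow : (fun j : Fin l => PowerSeries.mk fun k =>
      ∫ u in {u : I | prevEnd z i ≤ u ∧ (u : ℝ) < z i},
        coeff k (sourceSeries t a ((j : ℤ) - i) u) ∂abscissaMeasure t a) =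
      fun j : Fin l => sourceSeries t a ((j : ℤ) - i + 1) (z i) -
        sourceSeries t a ((j : ℤ) - i + 1) (prevEnd z i) := by
    ext j k
    rw [map_sub]
    simp only [sourceSeries, coeff_mk]
    rw [integral_div, integral_sourceCoeff_Ico t a _ (prevEnd_le hz h0 i), sub_div,
      add_assoc]
  rw [hrow, Matrix.det_updateRow_sub, det_updateRow_prevEnd, sub_zero]
  congr 3
  ext1 j
  simp [stateMatrix, derivative_sourceSeries]

end Determinant

/-! ### The volume of the sequences that survive -/

section Survival

open PowerSeries

variable {l : ℕ}

lemma measurableSet_isSlot {X : Type*} [MeasurableSpace X] {z : X → Fin l → ℝ} {u : X → ℝ}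
    (hz : Measurable z) (hu : Measurable u) (i : Fin l) :
    MeasurableSet {x | IsSlot (z x) (u x) i} := by
  have hzi : ∀ j, Measurable fun x => z x j := fun j => (measurable_pi_apply j).comp hz
  have : {x | IsSlot (z x) (u x) i} =
      (⋂ j, ⋂ (_ : j < i), {x | z x j ≤ u x}) ∩ {x | u x < z x i} := by
    ext x; simp [IsSlot]
  rw [this]
  exact (MeasurableSet.iInter fun j => MeasurableSet.iInter fun _ =>
    measurableSet_le (hzi j) hu).inter (measurableSet_lt hu (hzi i))

lemma measurableSet_survives (l N : ℕ) :
    MeasurableSet {q : (Fin l → ℝ) × (Fin N → I) | Survives N q.1 q.2} := by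
  induction N with
  | zero => simp [Survives]
  | succ N ih =>
    have h0 : Measurable fun q : (Fin l → ℝ) × (Fin (N + 1) → I) => (q.2 0 : ℝ) :=
      measurable_subtype_coe.comp ((measurable_pi_apply 0).comp measurable_snd)
    have : {q : (Fin l → ℝ) × (Fin (N + 1) → I) | Survives (N + 1) q.1 q.2} =
        ⋃ i, {q | IsSlot q.1 (q.2 0) i} ∩
          (fun q : (Fin l → ℝ) × (Fin (N + 1) → I) =>
            (Function.update q.1 i (q.2 0 : ℝ), Fin.tail q.2)) ⁻¹'
              {q | Survives N q.1 q.2} := by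
      ext q; simp [Survives]
    rw [this]
    refine MeasurableSet.iUnion fun i => (measurableSet_isSlot measurable_fst h0 i).inter ?_
    refine ih.preimage (Measurable.prodMk ?_ ?_)
    · exact measurable_update'.comp (measurable_fst.prodMk h0)
    · exact measurable_pi_lambda _ fun j => (measurable_pi_apply j.succ).comp measurable_snd

lemma measurableSet_survives_right (N : ℕ) (z : Fin l → ℝ) :
    MeasurableSet {v : Fin N → I | Survives N z v} :=
  (measurableSet_survives l N).preimage measurable_prodMk_left

/-- The survival volumes satisfy the backward equation of patience sorting, obtained by conditioning
on the first point. -/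
lemma pi_survives_succ (m : Measure I) [IsFiniteMeasure m] (N : ℕ) (z : Fin l → ℝ) :
    Measure.pi (fun _ : Fin (N + 1) => m) {v | Survives (N + 1) z v} =
      ∑ i, ∫⁻ u in {u : I | IsSlot z u i},
        Measure.pi (fun _ : Fin N => m) {v | Survives N (Function.update z i (u : ℝ)) v} ∂m := by
  have hslot : ∀ i, MeasurableSet {u : I | IsSlot z u i} := fun i =>
    measurableSet_isSlot measurable_const measurable_subtype_coe i
  have hsec : ∀ i, Measurable fun u : I =>
      Measure.pi (fun _ : Fin N => m) {v | Survives N (Function.update z i (u : ℝ)) v} := by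
    intro i
    have hS : MeasurableSet {q : I × (Fin N → I) |
        Survives N (Function.update z i (q.1 : ℝ)) q.2} :=
      (measurableSet_survives l N).preimage (((measurable_update z).comp
        (measurable_subtype_coe.comp measurable_fst)).prodMk measurable_snd)
    exact measurable_measure_prodMk_left hS
  have hmp := measurePreserving_piFinSuccAbove (fun _ : Fin (N + 1) => m) 0
  set B : Set (I × (Fin N → I)) :=
    {q | ∃ i, IsSlot z q.1 i ∧ Survives N (Function.update z i (q.1 : ℝ)) q.2} with hB
  have hpre : {v : Fin (N + 1) → I | Survives (N + 1) z v} =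
      MeasurableEquiv.piFinSuccAbove (fun _ => I) 0 ⁻¹' B := by
    ext v; rfl
  have hBm : MeasurableSet B := by
    have h1 := measurableSet_survives_right (N + 1) z
    rw [hpre] at h1
    exact (MeasurableEquiv.measurableSet_preimage _).1 h1
  rw [hpre, hmp.measure_preimage hBm.nullMeasurableSet, Measure.prod_apply hBm]
  have hsl : ∀ u : I, Measure.pi (fun _ : Fin N => m) (Prod.mk u ⁻¹' B) =
      ∑ i, ({u : I | IsSlot z u i}.indicator fun u =>
        Measure.pi (fun _ : Fin N => m)
          {v | Survives N (Function.update z i (u : ℝ)) v}) u := by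
    intro u
    by_cases h : ∃ i, IsSlot z u i
    · obtain ⟨i, hi⟩ := h
      have : Prod.mk u ⁻¹' B = {v | Survives N (Function.update z i (u : ℝ)) v} := by
        ext v
        constructor
        · rintro ⟨k, hk, hv⟩
          rwa [hk.unique hi] at hv
        · exact fun hv => ⟨i, hi, hv⟩
      rw [this, Finset.sum_eq_single i, Set.indicator_of_mem (s := {u : I | IsSlot z u i}) hi]
      · intro k _ hk
        exact Set.indicator_of_notMem (s := {u : I | IsSlot z u k})
          (fun hk' => hk (IsSlot.unique hk' hi)) _
      · simp
    · have : Prod.mk u ⁻¹' B = ∅ := by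
        ext v
        simp only [Set.mem_preimage, Set.mem_empty_iff_false, iff_false]
        rintro ⟨k, hk, -⟩
        exact h ⟨k, hk⟩
      rw [this, measure_empty, Finset.sum_eq_zero]
      intro k _
      exact Set.indicator_of_notMem (s := {u : I | IsSlot z u k}) (fun hk => h ⟨k, hk⟩) _
  have hcongr : ∀ᵐ u ∂m, Measure.pi (fun _ : Fin N => m) (Prod.mk u ⁻¹' B) =
      ∑ i, ({u : I | IsSlot z u i}.indicator fun u =>
        Measure.pi (fun _ : Fin N => m)
          {v | Survives N (Function.update z i (u : ℝ)) v}) u := Filter.Eventually.of_forall hsl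
  refine (lintegral_congr_ae hcongr).trans ?_
  rw [lintegral_finsetSum _ fun i _ => (hsec i).indicator (hslot i)]
  exact Finset.sum_congr rfl fun i _ => lintegral_indicator (hslot i) _

/-- The volume of the sequences of `N` points that can be put on the piles is a coefficient of a
determinant. -/
theorem pi_survives (t a : ℝ≥0) (N : ℕ) {z : Fin l → ℝ} (hz : Monotone z) (h0 : ∀ i, 0 ≤ z i) :
    (Measure.pi fun _ : Fin N => abscissaMeasure t a).real {v | Survives N z v} =
      N ! * coeff N (stateMatrix t a z).det := by
  induction N generalizing z with
  | zero =>
    have := constantCoeff_det_stateMatrix t a z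
    rw [← coeff_zero_eq_constantCoeff_apply] at this
    rw [this]
    simp [Survives, measureReal_def]
  | succ N ih =>
    have hslot : ∀ i, MeasurableSet {u : I | IsSlot z u i} := fun i =>
      measurableSet_isSlot measurable_const measurable_subtype_coe i
    have hstep : ∀ i, ∀ u : I, IsSlot z u i →
        (Measure.pi fun _ : Fin N => abscissaMeasure t a).real
          {v | Survives N (Function.update z i (u : ℝ)) v} =
        N ! * coeff N (stateMatrix t a (Function.update z i (u : ℝ))).det := by
      intro i u hi
      refine ih (hi.monotone_update hz) fun k => ?_
      rcases eq_or_ne k i with rfl | hk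
      · simpa using u.2.1
      · simpa [Function.update_of_ne hk] using h0 k
    have hterm : ∀ i, ∫⁻ u in {u : I | IsSlot z u i},
        Measure.pi (fun _ : Fin N => abscissaMeasure t a)
          {v | Survives N (Function.update z i (u : ℝ)) v} ∂abscissaMeasure t a =
        ENNReal.ofReal (∫ u in {u : I | IsSlot z u i},
          N ! * coeff N (stateMatrix t a (Function.update z i (u : ℝ))).det
            ∂abscissaMeasure t a) := by
      intro i
      rw [ofReal_integral_eq_lintegral_ofReal]
      · refine setLIntegral_congr_fun (hslot i) fun u hu => ?_
        rw [← hstep i u hu, ofReal_measureReal]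
      · exact (integrable_coeff_det_update t a z i N _).const_mul _
      · refine (ae_restrict_iff' (hslot i)).2 (Filter.Eventually.of_forall fun u hu => ?_)
        exact measureReal_nonneg.trans_eq (hstep i u hu)
    have hpos : ∀ i, 0 ≤ ∫ u in {u : I | IsSlot z u i},
        N ! * coeff N (stateMatrix t a (Function.update z i (u : ℝ))).det
          ∂abscissaMeasure t a := by
      intro i
      refine setIntegral_nonneg (hslot i) fun u hu => ?_
      rw [← hstep i u hu]
      exact measureReal_nonneg
    rw [measureReal_def, pi_survives_succ, Finset.sum_congr rfl fun i _ => hterm i,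
      ← ENNReal.ofReal_sum_of_nonneg fun i _ => hpos i,
      ENNReal.toReal_ofReal (Finset.sum_nonneg fun i _ => hpos i)]
    simp_rw [integral_const_mul]
    rw [← Finset.mul_sum, sum_integral_slot_coeff_det t a hz h0, Nat.factorial_succ]
    push_cast
    ring

end Survival

/-! ### Integration over increasing sequences -/

section IncreasingSequences

lemma measurableSet_strictMono {X : Type*} [MeasurableSpace X] {b : ℕ} {w : X → Fin b → I}
    (hw : Measurable w) : MeasurableSet {x | StrictMono (w x)} := by
  have : {x | StrictMono (w x)} = ⋂ i, ⋂ j, ⋂ (_ : i < j), {x | w x i < w x j} := by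
    ext x; simp [StrictMono]
  rw [this]
  exact MeasurableSet.iInter fun i => MeasurableSet.iInter fun j => MeasurableSet.iInter fun _ =>
    measurableSet_lt ((measurable_pi_apply i).comp hw) ((measurable_pi_apply j).comp hw)

lemma strictMono_snoc_iff {b : ℕ} (x : Fin b → I) (u : I) :
    StrictMono (Fin.snoc x u : Fin (b + 1) → I) ↔ StrictMono x ∧ ∀ k, x k < u := by
  constructor
  · intro h
    refine ⟨fun i j hij => ?_, fun k => ?_⟩
    · simpa using h (Fin.castSucc_lt_castSucc_iff.2 hij)
    · simpa using h (Fin.castSucc_lt_last k)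
  · rintro ⟨h1, h2⟩ i j
    refine Fin.lastCases (fun hij => ?_) (fun j hij => ?_) j
    · obtain ⟨k, rfl⟩ := Fin.exists_castSucc_eq.2 hij.ne
      simpa using h2 k
    · obtain ⟨k, rfl⟩ := Fin.exists_castSucc_eq.2 (hij.trans (Fin.castSucc_lt_last j)).ne
      simpa using h1 (Fin.castSucc_lt_castSucc_iff.1 hij)

lemma setIntegral_strictMono_succ (ν : Measure I) [IsFiniteMeasure ν] {b : ℕ}
    {f : (Fin (b + 1) → I) → ℝ} (hf : Integrable f (Measure.pi fun _ => ν)) :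
    IntegrableOn (fun x : Fin b → I => ∫ u in {u | ∀ k, x k < u}, f (Fin.snoc x u) ∂ν)
        {x | StrictMono x} (Measure.pi fun _ => ν) ∧
      ∫ w in {w | StrictMono w}, f w ∂Measure.pi (fun _ : Fin (b + 1) => ν) =
        ∫ x in {x | StrictMono x}, ∫ u in {u | ∀ k, x k < u}, f (Fin.snoc x u) ∂ν
          ∂Measure.pi (fun _ : Fin b => ν) := by
  have hSM : ∀ c, MeasurableSet {w : Fin c → I | StrictMono w} := fun c =>
    measurableSet_strictMono measurable_id
  have hU : ∀ x : Fin b → I, MeasurableSet {u : I | ∀ k, x k < u} := fun x => by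
    have : {u : I | ∀ k, x k < u} = ⋂ k, Set.Ioi (x k) := by ext u; simp
    rw [this]
    exact MeasurableSet.iInter fun k => measurableSet_Ioi
  have hmp := (measurePreserving_piFinSuccAbove (fun _ : Fin (b + 1) => ν) (Fin.last b)).symm
  set e := (MeasurableEquiv.piFinSuccAbove (fun _ : Fin (b + 1) => I) (Fin.last b)).symm with he
  have hev : ∀ u x, e (u, x) = (Fin.snoc x u : Fin (b + 1) → I) := fun u x =>
    Fin.insertNth_last' u x
  have hg := hf.indicator (hSM (b + 1))
  have hg' : Integrable (fun q => {w : Fin (b + 1) → I | StrictMono w}.indicator f (e q))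
      (ν.prod (Measure.pi fun _ : Fin b => ν)) :=
    (hmp.integrable_comp_emb e.measurableEmbedding).2 hg
  have hinner : ∀ x : Fin b → I,
      ∫ u, {w : Fin (b + 1) → I | StrictMono w}.indicator f (e (u, x)) ∂ν =
        {x : Fin b → I | StrictMono x}.indicator
          (fun x => ∫ u in {u | ∀ k, x k < u}, f (Fin.snoc x u) ∂ν) x := by
    intro x
    by_cases hx : StrictMono x
    · rw [Set.indicator_of_mem (s := {x : Fin b → I | StrictMono x}) hx,
        ← integral_indicator (hU x)]
      refine integral_congr_ae (Filter.Eventually.of_forall fun u => ?_)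
      simp only [hev]
      by_cases hu : ∀ k, x k < u
      · rw [Set.indicator_of_mem (s := {u | ∀ k, x k < u}) hu, Set.indicator_of_mem
          (s := {w : Fin (b + 1) → I | StrictMono w}) ((strictMono_snoc_iff x u).2 ⟨hx, hu⟩)]
      · rw [Set.indicator_of_notMem (s := {u | ∀ k, x k < u}) hu, Set.indicator_of_notMem
          (s := {w : Fin (b + 1) → I | StrictMono w})
          (fun h => hu ((strictMono_snoc_iff x u).1 h).2)]
    · rw [Set.indicator_of_notMem (s := {x : Fin b → I | StrictMono x}) hx]
      refine integral_eq_zero_of_ae (Filter.Eventually.of_forall fun u => ?_)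
      simp only [hev]
      exact Set.indicator_of_notMem (s := {w : Fin (b + 1) → I | StrictMono w})
        (fun h => hx ((strictMono_snoc_iff x u).1 h).1) _
  constructor
  · rw [← integrable_indicator_iff (hSM b)]
    refine hg'.integral_prod_right.congr (Filter.Eventually.of_forall fun x => ?_)
    exact hinner x
  · rw [← integral_indicator (hSM (b + 1)), ← hmp.integral_comp', integral_prod_symm _ hg',
      ← integral_indicator (hSM b)]
    exact integral_congr_ae (Filter.Eventually.of_forall hinner)

end IncreasingSequences

/-! ### Power series with bounded measurable coefficients -/

section BoundedCoefficients

open PowerSeries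

variable {X : Type*} [MeasurableSpace X]

/-- The coefficients of a family of power series are bounded measurable functions of the
parameter. -/
def BoundedCoeffs (f : X → ℝ⟦X⟧) : Prop :=
  ∀ k, Measurable (fun x => coeff k (f x)) ∧ ∃ C, ∀ x, |coeff k (f x)| ≤ C

lemma BoundedCoeffs.const (f : ℝ⟦X⟧) : BoundedCoeffs fun _ : X => f :=
  fun _ => ⟨measurable_const, _, fun _ => le_rfl⟩

lemma BoundedCoeffs.sum {ι : Type*} (s : Finset ι) {f : ι → X → ℝ⟦X⟧}
    (hf : ∀ i ∈ s, BoundedCoeffs (f i)) : BoundedCoeffs fun x => ∑ i ∈ s, f i x := by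
  intro k
  simp_rw [map_sum]
  refine ⟨Finset.measurable_sum _ fun i hi => (hf i hi k).1, ?_⟩
  choose! C hC using fun i (hi : i ∈ s) => (hf i hi k).2
  exact ⟨∑ i ∈ s, C i, fun x => (Finset.abs_sum_le_sum_abs _ _).trans
    (Finset.sum_le_sum fun i hi => hC i hi x)⟩

lemma BoundedCoeffs.mul {f g : X → ℝ⟦X⟧} (hf : BoundedCoeffs f) (hg : BoundedCoeffs g) :
    BoundedCoeffs fun x => f x * g x := by
  intro k
  simp_rw [coeff_mul]
  refine ⟨Finset.measurable_sum _ fun p _ => (hf p.1).1.mul (hg p.2).1, ?_⟩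
  choose C hC using fun i => (hf i).2
  choose D hD using fun i => (hg i).2
  refine ⟨∑ p ∈ Finset.HasAntidiagonal.antidiagonal k, C p.1 * D p.2, fun x =>
    (Finset.abs_sum_le_sum_abs _ _).trans (Finset.sum_le_sum fun p _ => ?_)⟩
  rw [abs_mul]
  exact mul_le_mul (hC _ x) (hD _ x) (abs_nonneg _) ((abs_nonneg _).trans (hC _ x))

lemma BoundedCoeffs.prod {ι : Type*} (s : Finset ι) {f : ι → X → ℝ⟦X⟧}
    (hf : ∀ i ∈ s, BoundedCoeffs (f i)) : BoundedCoeffs fun x => ∏ i ∈ s, f i x := by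
  classical
  induction s using Finset.induction_on with
  | empty => simpa using BoundedCoeffs.const 1
  | insert a s ha ih =>
    simp_rw [Finset.prod_insert ha]
    exact (hf a (Finset.mem_insert_self a s)).mul
      (ih fun i hi => hf i (Finset.mem_insert_of_mem hi))

lemma BoundedCoeffs.det {n : Type*} [Fintype n] [DecidableEq n] {M : X → Matrix n n ℝ⟦X⟧}
    (hM : ∀ i j, BoundedCoeffs fun x => M x i j) : BoundedCoeffs fun x => (M x).det := by
  simp_rw [Matrix.det_apply']
  exact BoundedCoeffs.sum _ fun e _ =>
    (BoundedCoeffs.const _).mul (BoundedCoeffs.prod _ fun i _ => hM _ _)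

lemma BoundedCoeffs.integrable {f : X → ℝ⟦X⟧} (hf : BoundedCoeffs f) (k : ℕ) (μ : Measure X)
    [IsFiniteMeasure μ] : Integrable (fun x => coeff k (f x)) μ := by
  obtain ⟨hm, C, hC⟩ := hf k
  exact Integrable.of_bound hm.aestronglyMeasurable C (Filter.Eventually.of_forall hC)

lemma boundedCoeffs_sourceSeries (t a : ℝ) (d : ℤ) {g : X → ℝ} (hg : Measurable g) :
    BoundedCoeffs fun x => sourceSeries t a d (g x) := by
  intro k
  simp only [sourceSeries, coeff_mk]
  refine ⟨((measurable_sourceCoeff t a _).comp hg).div_const _, ?_⟩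
  obtain ⟨C, hC⟩ := exists_abs_sourceCoeff_le t a (k + d)
  refine ⟨C / k !, fun x => ?_⟩
  rw [abs_div, Nat.abs_cast]
  exact div_le_div_of_nonneg_right (hC _) (by positivity)

end BoundedCoefficients

/-! ### Integration over the sources on the bottom edge -/

section Bottom

open PowerSeries

variable {l : ℕ}

/-- The coefficient of `w ^ d` in `(1 + b / w) * exp (X / w) * g 2`, where
`g 2 = (1 + a * w) * exp (t * w)` is the generating function of the numbers
`sourceCoeff t a n 2`. -/
def edgeSeries (t a b : ℝ) (d : ℤ) : ℝ⟦X⟧ :=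
  sourceSeries t a d 2 + C b * sourceSeries t a (d + 1) 2

/-- The Toeplitz matrix of `edgeSeries t a b`. -/
def edgeMatrix (t a b : ℝ) (l : ℕ) : Matrix (Fin l) (Fin l) ℝ⟦X⟧ :=
  Matrix.of fun i j => edgeSeries t a b ((j : ℤ) - i)

/-- The first `i` rows are those of `stateMatrix t a z`, the others are those of
`edgeMatrix t a b l`. Its determinant results from integrating over all bottom sources but the
first `i`. -/
def mixedMatrix (t a b : ℝ) (i : ℕ) (z : Fin l → ℝ) : Matrix (Fin l) (Fin l) ℝ⟦X⟧ :=
  Matrix.of fun r j =>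
    if (r : ℕ) < i then sourceSeries t a ((j : ℤ) - r) (z r) else edgeSeries t a b ((j : ℤ) - r)

lemma mixedMatrix_update (t a b : ℝ) (i : Fin l) (z : Fin l → ℝ) (u : ℝ) :
    mixedMatrix t a b (i + 1) (Function.update z i u) =
      (mixedMatrix t a b (i + 1) z).updateRow i fun j => sourceSeries t a ((j : ℤ) - i) u := by
  ext1 r j
  rcases eq_or_ne r i with rfl | h
  · simp [mixedMatrix]
  · simp [mixedMatrix, Matrix.updateRow_ne h, Function.update_of_ne h]

lemma mixedMatrix_eq_updateRow (t a b : ℝ) (i : Fin l) (z : Fin l → ℝ) :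
    mixedMatrix t a b i z = (mixedMatrix t a b (i + 1) z).updateRow i
      ((fun j : Fin l => sourceSeries t a ((j : ℤ) - i) 2) +
        (C b : ℝ⟦X⟧) • fun j : Fin l => sourceSeries t a ((j : ℤ) - i + 1) 2) := by
  ext1 r j
  rcases eq_or_ne r i with rfl | h
  · simp [mixedMatrix, edgeSeries]
  · have : (r : ℕ) < i ↔ (r : ℕ) < i + 1 := by
      have : (r : ℕ) ≠ i := fun h' => h (Fin.ext h')
      omega
    simp only [mixedMatrix, Matrix.updateRow_ne h, Matrix.of_apply, this]

/-- Each row of `edgeMatrix` below the row `i` differs by a multiple of the preceding row from the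
corresponding row of `stateMatrix`. -/
lemma det_updateRow_mixedMatrix (t a b : ℝ) (i : Fin l) {z : Fin l → ℝ}
    (hz : ∀ r, i ≤ r → z r = 2) :
    ((mixedMatrix t a b (i + 1) z).updateRow i fun j => sourceSeries t a ((j : ℤ) - i) 2).det =
      (stateMatrix t a z).det := by
  obtain ⟨n, rfl⟩ : ∃ n, l = n + 1 := ⟨l - 1, by have := i.2; omega⟩
  have hrow : ∀ r j, r ≤ i → stateMatrix t a z r j = ((mixedMatrix t a b (i + 1) z).updateRow i
      fun j => sourceSeries t a ((j : ℤ) - i) 2) r j := by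
    intro r j hr
    rcases eq_or_ne r i with rfl | h
    · simp [stateMatrix, hz r le_rfl]
    · have : (r : ℕ) < i + 1 := Nat.lt_succ_of_le hr
      simp only [mixedMatrix, Matrix.updateRow_ne h, Matrix.of_apply, this, stateMatrix, if_true]
  refine (Matrix.det_eq_of_forall_row_eq_smul_add_pred
    (fun r : Fin n => if i ≤ r.castSucc then -C b else 0) (fun j => hrow 0 j (Fin.zero_le _))
    fun r j => ?_).symm
  split_ifs with h
  · have h1 : i < r.succ := Fin.lt_def.2 (Nat.lt_succ_of_le h)
    have h2 : ¬ (r : ℕ) + 1 < (i : ℕ) + 1 := by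
      have : (i : ℕ) ≤ r := h
      omega
    simp only [Matrix.updateRow_ne h1.ne', mixedMatrix, stateMatrix, Matrix.of_apply, hz _ h,
      hz _ h1.le, edgeSeries, Fin.val_succ, h2, if_false, Fin.val_castSucc]
    push_cast
    rw [show (j : ℤ) - (r + 1) + 1 = j - r by ring]
    ring
  · rw [zero_mul, add_zero]
    refine hrow _ j (Fin.le_def.2 ?_)
    have h' : (r : ℕ) < i := not_le.1 h
    rw [Fin.val_succ]
    omega

lemma boundedCoeffs_det_mixedMatrix {X : Type*} [MeasurableSpace X] (t a b : ℝ) (i : ℕ)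
    {z : X → Fin l → ℝ} (hz : Measurable z) :
    BoundedCoeffs fun x => (mixedMatrix t a b i (z x)).det := by
  refine BoundedCoeffs.det fun r j => ?_
  simp only [mixedMatrix, Matrix.of_apply]
  split_ifs
  · exact boundedCoeffs_sourceSeries t a _ ((measurable_pi_apply r).comp hz)
  · exact BoundedCoeffs.const _

lemma mixedMatrix_of_le (t a b : ℝ) {i : ℕ} (hi : l ≤ i) (z : Fin l → ℝ) :
    mixedMatrix t a b i z = stateMatrix t a z := by
  ext1 r j
  simp [mixedMatrix, stateMatrix, r.2.trans_le hi]

/-- Integration over the position of the bottom source `i`, which lies to the right of the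
preceding one. -/
lemma coeff_det_mixedMatrix (t : ℝ≥0) (a b : ℝ) (N : ℕ) (i : Fin l) (hi : 0 < (i : ℕ))
    {z : Fin l → ℝ} (hz : ∀ r, i ≤ r → z r = 2) {x : I} (hx : 0 < x)
    (hzx : z ⟨i - 1, by omega⟩ = x) :
    coeff N (mixedMatrix t a b i z).det = coeff N (stateMatrix t a z).det +
      b * ∫ u in Set.Ioi x, coeff N (mixedMatrix t a b (i + 1) (Function.update z i u)).det
        ∂(t • volume : Measure I) := by
  simp_rw [mixedMatrix_update]
  rw [(integral_coeff_det_updateRow _ i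
    (fun (u : I) j => sourceSeries t a ((j : ℤ) - i) u)
    (fun j k => integrable_coeff_sourceSeries t a _ k _) N).2]
  have hrow : (fun j : Fin l => PowerSeries.mk fun k =>
      ∫ u in Set.Ioi x, coeff k (sourceSeries t a ((j : ℤ) - i) u) ∂(t • volume : Measure I)) =
      fun j : Fin l => sourceSeries t a ((j : ℤ) - i + 1) 2 -
        sourceSeries t a ((j : ℤ) - i + 1) x := by
    ext j k
    rw [map_sub]
    simp only [sourceSeries, coeff_mk]
    rw [integral_div, Measure.restrict_smul, integral_smul_nnreal_measure, NNReal.smul_def,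
      smul_eq_mul, integral_sourceCoeff_volume_gt _ _ _ hx, sub_div, add_assoc]
  have hprev : ((mixedMatrix t a b (i + 1) z).updateRow i fun j =>
      sourceSeries t a ((j : ℤ) - i + 1) x).det = 0 := by
    have hne : (⟨(i : ℕ) - 1, by omega⟩ : Fin l) ≠ i := by
      rw [Ne, Fin.ext_iff]; simp only; omega
    refine Matrix.det_zero_of_row_eq hne ?_
    rw [Matrix.updateRow_self, Matrix.updateRow_ne hne]
    ext1 j
    simp only [mixedMatrix, Matrix.of_apply, hzx, show (i : ℕ) - 1 < i + 1 by omega, if_true]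
    congr 1
    push_cast [Nat.cast_sub (show 1 ≤ (i : ℕ) from hi)]
    ring
  rw [hrow, Matrix.det_updateRow_sub, hprev, sub_zero, mixedMatrix_eq_updateRow,
    Matrix.det_updateRow_add, Matrix.det_updateRow_smul, det_updateRow_mixedMatrix _ _ _ _ hz,
    map_add, coeff_C_mul]

lemma mixedMatrix_zero (t a b : ℝ) (z : Fin l → ℝ) :
    mixedMatrix t a b 0 z = edgeMatrix t a b l := by
  ext1 r j
  simp [mixedMatrix, edgeMatrix]

/-- Integration over the position of the first bottom source. The atom at the origin, which does
not carry a bottom source, produces the minor. -/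
lemma coeff_det_edgeMatrix (t : ℝ≥0) (a b : ℝ) (N : ℕ) :
    coeff N ((edgeMatrix t a b (l + 1)).det - C (a * b) * (edgeMatrix t a b l).det) =
      coeff N (stateMatrix t a fun _ : Fin (l + 1) => 2).det +
        b * ∫ u, coeff N (mixedMatrix t a b 1
          (Function.update (fun _ : Fin (l + 1) => (2 : ℝ)) 0 u)).det
            ∂(t • volume : Measure I) := by
  have hupd := mixedMatrix_update t a b (0 : Fin (l + 1)) (fun _ => 2)
  simp only [Fin.coe_ofNat_eq_mod, Nat.zero_mod, zero_add] at hupd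
  simp_rw [hupd]
  rw [(integral_coeff_det_updateRow _ 0
    (fun (u : I) j => sourceSeries t a ((j : ℤ) - (0 : ℕ)) u)
    (fun j k => integrable_coeff_sourceSeries t a _ k _) N).2]
  have hrow : (fun j : Fin (l + 1) => PowerSeries.mk fun k =>
      ∫ u, coeff k (sourceSeries t a ((j : ℤ) - (0 : ℕ)) u) ∂(t • volume : Measure I)) =
      fun j : Fin (l + 1) => sourceSeries t a ((j : ℤ) - (0 : ℕ) + 1) 2 -
        ((C a : ℝ⟦X⟧) • Pi.single (0 : Fin (l + 1)) (1 : ℝ⟦X⟧) : Fin (l + 1) → ℝ⟦X⟧) j := by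
    ext j k
    rw [map_sub]
    simp only [sourceSeries, coeff_mk]
    rw [integral_div, integral_smul_nnreal_measure, NNReal.smul_def,
      smul_eq_mul, integral_sourceCoeff_volume, sub_div, expCoeff_zero_right (by omega), zero_add,
      add_assoc]
    congr 1
    rcases eq_or_ne j 0 with rfl | hj
    · rcases Nat.eq_zero_or_pos k with rfl | hk
      · simp
      · rw [expCoeff_zero_right (by simp; omega)]
        simp [coeff_C, hk.ne']
    · have : (j : ℕ) ≠ 0 := fun h => hj (Fin.ext h)
      rw [expCoeff_zero_right (by omega)]
      simp [hj]
  have hminor : ((mixedMatrix t a b 1 fun _ : Fin (l + 1) => 2).updateRow 0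
      (Pi.single (0 : Fin (l + 1)) (1 : ℝ⟦X⟧))).det = (edgeMatrix t a b l).det := by
    rw [Matrix.det_succ_row_zero, Finset.sum_eq_single 0]
    · simp only [Fin.val_zero, pow_zero, Matrix.updateRow_self, Pi.single_eq_same, one_mul]
      congr 1
      ext1 r j
      simp [mixedMatrix, edgeMatrix]
    · intro j _ hj
      simp [hj]
    · simp
  have hedge := mixedMatrix_eq_updateRow t a b (0 : Fin (l + 1)) (fun _ => 2)
  have hops := det_updateRow_mixedMatrix t a b (0 : Fin (l + 1)) (z := fun _ => 2)
    (fun _ _ => rfl)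
  simp only [Fin.coe_ofNat_eq_mod, Nat.zero_mod, zero_add] at hedge hops
  rw [hrow, Matrix.det_updateRow_sub, Matrix.det_updateRow_smul, hminor,
    ← mixedMatrix_zero t a b (fun _ => 2), hedge, Matrix.det_updateRow_add,
    Matrix.det_updateRow_smul, hops, map_mul]
  simp only [map_sub, map_add, coeff_C_mul, mul_assoc]
  ring

lemma measurable_bottomState (l b : ℕ) : Measurable (bottomState l (b := b)) := by
  refine measurable_pi_lambda _ fun i => ?_
  unfold bottomState
  split_ifs with h
  · exact measurable_subtype_coe.comp (measurable_pi_apply _)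
  · exact measurable_const

lemma bottomState_snoc {b : ℕ} (hb : b < l) (x : Fin b → I) (u : I) :
    bottomState l (Fin.snoc x u : Fin (b + 1) → I) =
      Function.update (bottomState l x) ⟨b, hb⟩ (u : ℝ) := by
  ext i
  rcases lt_trichotomy (i : ℕ) b with h | h | h
  · have hne : i ≠ ⟨b, hb⟩ := fun h' => h.ne (Fin.ext_iff.1 h')
    simp [bottomState, Function.update_of_ne hne, h, h.trans (Nat.lt_succ_self b), Fin.snoc]
  · have he : i = ⟨b, hb⟩ := Fin.ext h
    subst he
    simp [bottomState, Fin.snoc]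
  · have hne : i ≠ ⟨b, hb⟩ := fun h' => h.ne' (Fin.ext_iff.1 h')
    simp [bottomState, Function.update_of_ne hne, h.not_gt, show ¬ (i : ℕ) < b + 1 by omega]

/-- All bottom sources to the right of the first `i` have been integrated out. -/
lemma sum_integral_bottomState_from (t : ℝ≥0) (a b : ℝ) (N : ℕ) {i : ℕ} (hi : 0 < i)
    (hil : i ≤ l) :
    ∑ c ∈ Finset.Ico i (l + 1), b ^ c * ∫ x in {x : Fin c → I | StrictMono x},
        coeff N (stateMatrix t a (bottomState l x)).det
          ∂Measure.pi (fun _ => (t • volume : Measure I)) =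
      b ^ i * ∫ x in {x : Fin i → I | StrictMono x},
        coeff N (mixedMatrix t a b i (bottomState l x)).det
          ∂Measure.pi (fun _ => (t • volume : Measure I)) := by
  induction hil using Nat.decreasingInduction with
  | self => simp [mixedMatrix_of_le t a b le_rfl]
  | of_succ i hil ih =>
    rw [Finset.sum_eq_sum_Ico_succ_bot (by omega), ih (Nat.succ_pos i)]
    obtain ⟨h1, h2⟩ := setIntegral_strictMono_succ (t • volume : Measure I)
      ((boundedCoeffs_det_mixedMatrix t a b (i + 1)
        (measurable_bottomState l (i + 1))).integrable N
        (Measure.pi fun _ => (t • volume : Measure I)))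
    have hint : IntegrableOn (fun x : Fin i → I =>
        coeff N (stateMatrix t a (bottomState l x)).det) {x | StrictMono x}
        (Measure.pi fun _ => (t • volume : Measure I)) := by
      simp_rw [← mixedMatrix_of_le t a b le_rfl]
      exact ((boundedCoeffs_det_mixedMatrix t a b l (measurable_bottomState l i)).integrable N
        _).integrableOn
    rw [h2, pow_succ, mul_assoc, ← mul_add, ← integral_const_mul,
      ← integral_add hint (h1.const_mul b)]
    congr 1
    -- The smallest abscissa is almost surely positive.
    have hpos : ∀ᵐ x ∂Measure.pi (fun _ : Fin i => (t • volume : Measure I)),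
        0 < x ⟨i - 1, by omega⟩ := by
      refine (Measure.tendsto_eval_ae_ae (μ := fun _ : Fin i => (t • volume : Measure I))
        (i := ⟨i - 1, by omega⟩)).eventually ?_
      refine Measure.ae_smul_measure (?_ : ∀ᵐ u : I, 0 < u) t
      filter_upwards [compl_mem_ae_iff.2 (measure_singleton (0 : I))] with u hu
      exact lt_of_le_of_ne u.2.1 (Ne.symm hu)
    refine integral_congr_ae ?_
    filter_upwards [ae_restrict_of_ae hpos,
      ae_restrict_mem (measurableSet_strictMono measurable_id)] with x hx0 hx
    have hset : {u : I | ∀ k, x k < u} = Set.Ioi (x ⟨i - 1, by omega⟩) := by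
      ext u
      simp only [Set.mem_ofPred_eq, Set.mem_Ioi]
      refine ⟨fun h => h _, fun h k => lt_of_le_of_lt (hx.monotone ?_) h⟩
      rw [Fin.le_def]
      simp only
      omega
    rw [hset]
    simp_rw [bottomState_snoc hil]
    refine (coeff_det_mixedMatrix t a b N ⟨i, hil⟩ hi (fun r hr => ?_) hx0 ?_).symm
    · have : ¬ (r : ℕ) < i := not_lt.2 hr
      simp [bottomState, this]
    · simp [bottomState, show i - 1 < i by omega]

/-- The sum over all numbers of bottom sources is a coefficient of the difference of two Toeplitz
determinants. -/
theorem sum_integral_bottomState (t : ℝ≥0) (a b : ℝ) (N l : ℕ) :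
    ∑ c ∈ Finset.range (l + 1), b ^ c * ∫ x in {x : Fin c → I | StrictMono x},
        coeff N (stateMatrix t a (bottomState l x)).det
          ∂Measure.pi (fun _ => (t • volume : Measure I)) =
      coeff N ((edgeMatrix t a b l).det -
        C (a * b) * if l = 0 then 0 else (edgeMatrix t a b (l - 1)).det) := by
  have h0 : b ^ 0 * ∫ x in {x : Fin 0 → I | StrictMono x},
      coeff N (stateMatrix t a (bottomState l x)).det
        ∂Measure.pi (fun _ => (t • volume : Measure I)) =
      coeff N (stateMatrix t a fun _ : Fin l => 2).det := by
    have h1 : ∀ x : Fin 0 → I, bottomState l x = fun _ => 2 := fun x => by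
      ext i; simp [bottomState]
    have h2 : {x : Fin 0 → I | StrictMono x} = Set.univ := by
      ext x; simp [StrictMono]
    simp_rw [h1, h2]
    simp [measureReal_def]
  cases l with
  | zero =>
    rw [zero_add, Finset.sum_range_one, h0]
    simp
  | succ l =>
    rw [Finset.range_eq_Ico, Finset.sum_eq_sum_Ico_succ_bot (by omega), h0, zero_add,
      sum_integral_bottomState_from t a b N zero_lt_one (Nat.succ_pos l), if_neg (by omega),
      Nat.add_sub_cancel, coeff_det_edgeMatrix, pow_one]
    congr 2
    have hf := (boundedCoeffs_det_mixedMatrix t a b 1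
      (measurable_bottomState (l + 1) 1)).integrable N
        (Measure.pi fun _ => (t • volume : Measure I))
    refine (setIntegral_strictMono_succ _ hf).2.trans ?_
    have h2 : {x : Fin 0 → I | StrictMono x} = Set.univ := by
      ext x; simp [StrictMono]
    have h3 : ∀ x : Fin 0 → I, {u : I | ∀ k, x k < u} = Set.univ := fun x => by
      ext u; simp
    have h4 : ∀ x : Fin 0 → I, bottomState (l + 1) x = fun _ => 2 := fun x => by
      ext i; simp [bottomState]
    simp_rw [bottomState_snoc (Nat.succ_pos l), h2, h3, h4]
    simp [measureReal_def]

end Bottom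

/-! ### Symmetric functionals of Poisson samples -/

section PoissonSamples

open scoped ENNReal

variable {E : Type*} [MeasurableSpace E]

/-- The exponential generating function of the integrals of `H n` over the product measures
`μ ^ n`; up to the factor `exp (-μ univ)` this is an expectation for the Poisson process with
intensity `μ`. -/
def expSum (μ : Measure E) (H : (n : ℕ) → (Fin n → E) → ℝ≥0∞) : ℝ≥0∞ :=
  ∑' n : ℕ, (n ! : ℝ≥0∞)⁻¹ * ∫⁻ x, H n x ∂Measure.pi fun _ : Fin n => μ

lemma measurable_expSum {X : Type*} [MeasurableSpace X] (μ : Measure E) [IsFiniteMeasure μ]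
    {H : X → (n : ℕ) → (Fin n → E) → ℝ≥0∞}
    (hH : ∀ n, Measurable fun q : X × (Fin n → E) => H q.1 n q.2) :
    Measurable fun x => expSum μ (H x) :=
  Measurable.tsum fun n => (Measurable.lintegral_prod_right' (hH n)).const_mul _

lemma expSum_map {E' : Type*} [MeasurableSpace E'] (μ : Measure E) [IsFiniteMeasure μ]
    {g : E → E'} (hg : Measurable g) {H : (n : ℕ) → (Fin n → E') → ℝ≥0∞}
    (hH : ∀ n, Measurable (H n)) :
    expSum (μ.map g) H = expSum μ fun n x => H n fun i => g (x i) := by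
  refine tsum_congr fun n => ?_
  rw [← Measure.pi_map_pi (μ := fun _ : Fin n => μ) (f := fun _ => g)
    fun _ => hg.aemeasurable, lintegral_map (hH n)]
  exact measurable_pi_lambda _ fun i => hg.comp (measurable_pi_apply i)

lemma measurePreserving_comp_equiv {ι ι' : Type*} [Fintype ι] [Fintype ι'] (μ : ι → Measure E)
    [∀ i, SigmaFinite (μ i)] (e : ι' ≃ ι) :
    MeasurePreserving (fun p : ι → E => p ∘ e) (Measure.pi μ) (Measure.pi fun i => μ (e i)) :=
  (measurePreserving_piCongrLeft μ e).symm

/-- The coordinates are almost surely distinct when the measure has no atoms. -/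
lemma ae_injective_pi (ν : Measure I) [IsFiniteMeasure ν] [NullSingletonClass ν] (N : ℕ) :
    ∀ᵐ y ∂Measure.pi (fun _ : Fin N => ν), Function.Injective y := by
  have hpair : ∀ i j : Fin N, i ≠ j → ∀ᵐ y ∂Measure.pi (fun _ : Fin N => ν), y i ≠ y j := by
    intro i j hij
    obtain ⟨n, rfl⟩ : ∃ n, N = n + 1 := ⟨N - 1, by have := i.2; omega⟩
    obtain ⟨k, rfl⟩ := Fin.exists_succAbove_eq hij.symm
    have hmp := measurePreserving_piFinSuccAbove (fun _ : Fin (n + 1) => ν) i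
    have hms : MeasurableSet {q : I × (Fin n → I) | q.1 ≠ q.2 k} := by
      have : Measurable fun q : I × (Fin n → I) => q.2 k :=
        (measurable_pi_apply k).comp measurable_snd
      exact (measurableSet_eq_fun measurable_fst this).compl
    have hae : ∀ᵐ q ∂ν.prod (Measure.pi fun _ : Fin n => ν), q.1 ≠ q.2 k := by
      have hsw : ∀ᵐ q ∂(Measure.pi fun _ : Fin n => ν).prod ν, q.2 ≠ q.1 k := by
        refine (Measure.ae_prod_iff_ae_ae (p := fun q : (Fin n → I) × I => q.2 ≠ q.1 k)
          (hms.preimage measurable_swap)).2 ?_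
        exact Filter.Eventually.of_forall fun y => compl_mem_ae_iff.2 (measure_singleton (y k))
      have := (Measure.measurePreserving_swap (μ := ν)
        (ν := Measure.pi fun _ : Fin n => ν)).quasiMeasurePreserving.ae hsw
      exact this
    exact hmp.quasiMeasurePreserving.ae hae
  have hall : ∀ᵐ y ∂Measure.pi (fun _ : Fin N => ν), ∀ i j, i ≠ j → y i ≠ y j :=
    ae_all_iff.2 fun i => ae_all_iff.2 fun j => Filter.eventually_imp_distrib_left.2 (hpair i j)
  filter_upwards [hall] with y hy i j hij
  by_contra hne
  exact hy i j hne hij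

/-- A symmetric function can be integrated over the samples that are sorted by `key`. -/
lemma lintegral_eq_factorial_mul_lintegral_strictMono {N : ℕ} (μ : Measure E) [SigmaFinite μ]
    {key : E → I} (hkey : Measurable key)
    (hinj : ∀ᵐ p ∂Measure.pi (fun _ : Fin N => μ), Function.Injective fun i => key (p i))
    {f : (Fin N → E) → ℝ≥0∞} (hf : Measurable f)
    (hsymm : ∀ (e : Equiv.Perm (Fin N)) p, f (p ∘ e) = f p) :
    ∫⁻ p, f p ∂Measure.pi (fun _ : Fin N => μ) =
      N ! * ∫⁻ p in {p | StrictMono fun i => key (p i)}, f p ∂Measure.pi (fun _ : Fin N => μ) := by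
  have hkp : Measurable fun (p : Fin N → E) i => key (p i) :=
    measurable_pi_lambda _ fun i => hkey.comp (measurable_pi_apply i)
  have hA : MeasurableSet {p : Fin N → E | StrictMono fun i => key (p i)} :=
    measurableSet_strictMono hkp
  set g := {p : Fin N → E | StrictMono fun i => key (p i)}.indicator f with hg
  have hgm : Measurable g := hf.indicator hA
  have hdecomp : ∀ᵐ p ∂Measure.pi (fun _ : Fin N => μ),
      f p = ∑ e : Equiv.Perm (Fin N), g (p ∘ e) := by
    filter_upwards [hinj] with p hp
    set e₀ := Tuple.sort fun i => key (p i) with he₀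
    have hmono : Monotone ((fun i => key (p i)) ∘ e₀) := Tuple.monotone_sort _
    have hstrict : StrictMono fun i => key ((p ∘ e₀) i) :=
      hmono.strictMono_of_injective (hp.comp e₀.injective)
    rw [Finset.sum_eq_single e₀]
    · rw [hg, Set.indicator_of_mem (s := {p : Fin N → E | StrictMono fun i => key (p i)}) hstrict,
        hsymm]
    · intro e _ he
      refine Set.indicator_of_notMem (s := {p : Fin N → E | StrictMono fun i => key (p i)})
        (fun h : StrictMono fun i => key ((p ∘ e) i) => he ?_) _
      have : (fun i => key (p i)) ∘ e = (fun i => key (p i)) ∘ e₀ :=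
        Tuple.unique_monotone h.monotone hmono
      ext1 i
      exact hp (congrFun this i)
    · simp
  rw [lintegral_congr_ae hdecomp, lintegral_finsetSum]
  · have hterm : ∀ e : Equiv.Perm (Fin N), ∫⁻ p, g (p ∘ e) ∂Measure.pi (fun _ : Fin N => μ) =
        ∫⁻ p, g p ∂Measure.pi (fun _ : Fin N => μ) := fun e =>
      (measurePreserving_comp_equiv (fun _ : Fin N => μ) e).lintegral_comp hgm
    simp_rw [hterm]
    rw [Finset.sum_const, Finset.card_univ, Fintype.card_perm, Fintype.card_fin, nsmul_eq_mul,
      hg, lintegral_indicator hA]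
  · exact fun e _ => hgm.comp
      (measurePreserving_comp_equiv (fun _ : Fin N => μ) e).measurable

lemma pi_add_eq_sum {N : ℕ} (μ ν : Measure E) [IsFiniteMeasure μ] [IsFiniteMeasure ν] :
    Measure.pi (fun _ : Fin N => μ + ν) =
      Measure.sum fun s : Finset (Fin N) => Measure.pi fun i => if i ∈ s then μ else ν := by
  have hsf : ∀ (s : Finset (Fin N)) i, IsFiniteMeasure (if i ∈ s then μ else ν) := fun s i => by
    split_ifs <;> infer_instance
  refine Measure.pi_eq fun A hA => ?_
  rw [Measure.sum_apply _ (MeasurableSet.univ_pi hA), tsum_fintype]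
  simp_rw [Measure.pi_pi, Measure.add_apply]
  rw [Finset.prod_add, Finset.powerset_univ]
  refine Finset.sum_congr rfl fun s _ => ?_
  have : ∀ i, (if i ∈ s then μ else ν) (A i) = if i ∈ s then μ (A i) else ν (A i) := fun i => by
    split_ifs <;> rfl
  simp_rw [this]
  rw [Finset.prod_ite]
  congr 1
  · refine Finset.prod_congr ?_ fun _ _ => rfl
    ext; simp
  · refine Finset.prod_congr ?_ fun _ _ => rfl
    ext; simp

variable {Φ : Set E → ℝ≥0∞}

lemma lintegral_pi_ite {N : ℕ} (μ ν : Measure E) [IsFiniteMeasure μ] [IsFiniteMeasure ν]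
    (hΦ : ∀ k j, Measurable fun q : (Fin k → E) × (Fin j → E) =>
      Φ (Set.range q.1 ∪ Set.range q.2)) (s : Finset (Fin N)) {k j : ℕ} (hk : s.card = k)
    (hj : sᶜ.card = j) :
    ∫⁻ p, Φ (Set.range p) ∂Measure.pi (fun i => if i ∈ s then μ else ν) =
      ∫⁻ p, ∫⁻ q, Φ (Set.range p ∪ Set.range q) ∂Measure.pi (fun _ : Fin j => ν)
        ∂Measure.pi (fun _ : Fin k => μ) := by
  have hsf : ∀ i, IsFiniteMeasure (if i ∈ s then μ else ν) := fun i => by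
    split_ifs <;> infer_instance
  set e := finSumEquivOfFinset hk hj with he
  have hl : ∀ i, (if e (Sum.inl i) ∈ s then μ else ν) = μ := fun i => by
    rw [he, finSumEquivOfFinset_inl, if_pos (Finset.orderEmbOfFin_mem _ _ _)]
  have hr : ∀ i, (if e (Sum.inr i) ∈ s then μ else ν) = ν := fun i => by
    rw [he, finSumEquivOfFinset_inr, if_neg]
    exact Finset.mem_compl.1 (Finset.orderEmbOfFin_mem _ _ _)
  have hmp := (measurePreserving_sumPiEquivProdPi (X := fun _ : Fin k ⊕ Fin j => E)
    (fun i => if e i ∈ s then μ else ν)).comp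
      (measurePreserving_comp_equiv (fun i => if i ∈ s then μ else ν) e)
  simp_rw [hl, hr] at hmp
  have := hmp.lintegral_comp (hΦ k j)
  rw [lintegral_prod _ (hΦ k j).aemeasurable] at this
  rw [← this]
  refine lintegral_congr fun p => ?_
  congr 1
  ext x
  constructor
  · rintro ⟨i, rfl⟩
    obtain ⟨c, rfl⟩ := e.surjective i
    rcases c with c | c
    · exact Or.inl ⟨c, rfl⟩
    · exact Or.inr ⟨c, rfl⟩
  · rintro (⟨i, rfl⟩ | ⟨i, rfl⟩)
    · exact ⟨_, rfl⟩
    · exact ⟨_, rfl⟩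

/-- The superposition of two Poisson samples is a Poisson sample: the exponential generating
functions multiply. -/
lemma expSum_add (μ ν : Measure E) [IsFiniteMeasure μ] [IsFiniteMeasure ν]
    (hΦ : ∀ k j, Measurable fun q : (Fin k → E) × (Fin j → E) =>
      Φ (Set.range q.1 ∪ Set.range q.2)) :
    expSum (μ + ν) (fun _ p => Φ (Set.range p)) =
      expSum μ fun _ p => expSum ν fun _ q => Φ (Set.range p ∪ Set.range q) := by
  set F : ℕ → ℕ → ℝ≥0∞ := fun k j =>
    ∫⁻ p, ∫⁻ q, Φ (Set.range p ∪ Set.range q) ∂Measure.pi (fun _ : Fin j => ν)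
      ∂Measure.pi (fun _ : Fin k => μ) with hF
  have hN : ∀ N : ℕ, (N ! : ℝ≥0∞)⁻¹ *
      ∫⁻ p, Φ (Set.range p) ∂Measure.pi (fun _ : Fin N => μ + ν) =
      ∑ q ∈ Finset.HasAntidiagonal.antidiagonal N,
        (q.1 ! : ℝ≥0∞)⁻¹ * ((q.2 ! : ℝ≥0∞)⁻¹ * F q.1 q.2) := by
    intro N
    rw [pi_add_eq_sum, lintegral_sum_measure, tsum_fintype]
    have h1 : ∀ s : Finset (Fin N),
        ∫⁻ p, Φ (Set.range p) ∂Measure.pi (fun i => if i ∈ s then μ else ν) =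
          F s.card (N - s.card) := fun s =>
      lintegral_pi_ite μ ν hΦ s rfl (by rw [Finset.card_compl, Fintype.card_fin])
    simp_rw [h1]
    have h2 := Finset.sum_powerset_apply_card (fun c => F c (N - c))
      (x := (Finset.univ : Finset (Fin N)))
    rw [Finset.powerset_univ, Finset.card_univ, Fintype.card_fin] at h2
    rw [h2, Finset.Nat.sum_antidiagonal_eq_sum_range_succ_mk, Finset.mul_sum]
    refine Finset.sum_congr rfl fun c hc => ?_
    have hc' : c ≤ N := Nat.lt_succ_iff.1 (Finset.mem_range.1 hc)
    rw [nsmul_eq_mul, ← mul_assoc, ← mul_assoc]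
    congr 1
    have hfac := Nat.choose_mul_factorial_mul_factorial hc'
    have h0 : ∀ n : ℕ, (n ! : ℝ≥0∞) ≠ 0 := fun n => by exact_mod_cast n.factorial_ne_zero
    have ht : ∀ n : ℕ, (n ! : ℝ≥0∞) ≠ ∞ := fun n => ENNReal.natCast_ne_top _
    rw [← hfac, ← ENNReal.mul_inv (Or.inl (h0 _)) (Or.inl (ht _))]
    push_cast
    have hch : (N.choose c : ℝ≥0∞) ≠ 0 := by exact_mod_cast (Nat.choose_pos hc').ne'
    rw [mul_assoc, ENNReal.mul_inv (Or.inl hch) (Or.inl (ENNReal.natCast_ne_top _)), mul_comm,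
      ← mul_assoc, ENNReal.mul_inv_cancel hch (ENNReal.natCast_ne_top _), one_mul]
  have hrhs : (expSum μ fun _ p => expSum ν fun _ q => Φ (Set.range p ∪ Set.range q)) =
      ∑' k : ℕ, ∑' j : ℕ, (k ! : ℝ≥0∞)⁻¹ * ((j ! : ℝ≥0∞)⁻¹ * F k j) := by
    refine tsum_congr fun k => ?_
    have hm : ∀ j, Measurable fun p : Fin k → E =>
        ∫⁻ q, Φ (Set.range p ∪ Set.range q) ∂Measure.pi (fun _ : Fin j => ν) := fun j =>
      Measurable.lintegral_prod_right' (hΦ k j)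
    simp only [expSum]
    rw [lintegral_tsum fun j => ((hm j).const_mul _).aemeasurable, ← ENNReal.tsum_mul_left]
    refine tsum_congr fun j => ?_
    rw [lintegral_const_mul _ (hm j)]
  rw [hrhs, expSum]
  simp_rw [hN]
  rw [← ENNReal.tsum_prod (f := fun k j => (k ! : ℝ≥0∞)⁻¹ * ((j ! : ℝ≥0∞)⁻¹ * F k j)),
    ← Finset.HasAntidiagonal.sigmaAntidiagonalEquivProd.tsum_eq, ENNReal.tsum_sigma']
  refine tsum_congr fun N => ?_
  rw [tsum_fintype, Finset.univ_eq_attach]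
  exact (Finset.sum_attach (Finset.HasAntidiagonal.antidiagonal N)
    fun q => (q.1 ! : ℝ≥0∞)⁻¹ * ((q.2 ! : ℝ≥0∞)⁻¹ * F q.1 q.2)).symm

lemma map_restrict_infinitePi (ν : Measure E) [IsProbabilityMeasure ν] (n : ℕ) :
    (Measure.infinitePi fun _ : ℕ => ν).map (fun x (i : Fin n) => x i) =
      Measure.pi fun _ : Fin n => ν := by
  have hm : Measurable fun (x : ℕ → E) (i : Fin n) => x i :=
    measurable_pi_lambda _ fun i => measurable_pi_apply _
  refine (Measure.pi_eq fun A hA => ?_).symm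
  rw [Measure.map_apply hm (MeasurableSet.univ_pi hA)]
  have hpre : (fun (x : ℕ → E) (i : Fin n) => x i) ⁻¹' Set.univ.pi A =
      Set.pi (Finset.range n : Set ℕ) fun k => if h : k < n then A ⟨k, h⟩ else Set.univ := by
    ext x
    simp only [Set.mem_preimage, Set.mem_pi, Set.mem_univ, true_imp_iff, Finset.coe_range,
      Set.mem_Iio]
    constructor
    · intro h k hk
      simpa [hk] using h ⟨k, hk⟩
    · intro h i
      simpa using h i i.2
  rw [hpre, Measure.infinitePi_pi]
  · rw [Finset.prod_range]
    simp
  · intro k hk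
    rw [dif_pos (Finset.mem_range.1 hk)]
    exact hA _

lemma pi_smul_eq {N : ℕ} (c : ℝ≥0) (μ : Measure E) [IsFiniteMeasure μ] :
    Measure.pi (fun _ : Fin N => c • μ) = c ^ N • Measure.pi fun _ : Fin N => μ := by
  refine Measure.pi_eq fun A _ => ?_
  rw [Measure.smul_apply, Measure.pi_pi]
  simp_rw [Measure.smul_apply, ENNReal.smul_def, smul_eq_mul, Finset.prod_mul_distrib]
  simp

/-- Integration against the law of a Poisson sample, as an exponential generating function of
integrals over product measures. -/
lemma lintegral_poissonSampleLaw (r : ℝ≥0) (ν : Measure E) [IsProbabilityMeasure ν]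
    {H : (n : ℕ) → (Fin n → E) → ℝ≥0∞} (hH : ∀ n, Measurable (H n)) :
    ∫⁻ q, H q.1 (fun i => q.2 i) ∂poissonSampleLaw r ν =
      ENNReal.ofReal (Real.exp (-r)) * expSum (r • ν) H := by
  have hres : ∀ n : ℕ, Measurable fun (x : ℕ → E) (i : Fin n) => x i := fun n =>
    measurable_pi_lambda _ fun i => measurable_pi_apply _
  have hm : Measurable fun q : ℕ × (ℕ → E) => H q.1 fun i => q.2 i :=
    measurable_from_prod_countable_right fun n => (hH n).comp (hres n)
  rw [expSum, poissonSampleLaw, lintegral_prod _ hm.aemeasurable, lintegral_countable',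
    ← ENNReal.tsum_mul_left]
  refine tsum_congr fun n => ?_
  have h1 : ∫⁻ x, H n (fun i => x i) ∂(Measure.infinitePi fun _ : ℕ => ν) =
      ∫⁻ x, H n x ∂Measure.pi fun _ : Fin n => ν := by
    rw [← map_restrict_infinitePi ν n, lintegral_map (hH n) (hres n)]
  have h2 : ENNReal.ofReal (Real.exp (-r) * r ^ n / n !) =
      ENNReal.ofReal (Real.exp (-r)) * ((n ! : ℝ≥0∞)⁻¹ * (r : ℝ≥0∞) ^ n) := by
    rw [mul_div_assoc, ENNReal.ofReal_mul (Real.exp_nonneg _),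
      ENNReal.ofReal_div_of_pos (by positivity), ← NNReal.coe_pow, ENNReal.ofReal_coe_nnreal,
      ENNReal.coe_pow, ENNReal.ofReal_natCast, div_eq_mul_inv, mul_comm ((r : ℝ≥0∞) ^ n)]
  rw [h1, poissonMeasure_singleton, h2, pi_smul_eq, lintegral_smul_measure, ENNReal.smul_def,
    smul_eq_mul]
  push_cast
  ring

instance (r : ℝ≥0) (ν : Measure E) [IsProbabilityMeasure ν] : SFinite (poissonSampleLaw r ν) := by
  unfold poissonSampleLaw; infer_instance

/-- Integration against three independent Poisson samples. -/
lemma lintegral_poissonSampleLaw₃ {E₁ E₂ E₃ : Type*} [MeasurableSpace E₁] [MeasurableSpace E₂]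
    [MeasurableSpace E₃] (r₁ r₂ r₃ : ℝ≥0) (ν₁ : Measure E₁) (ν₂ : Measure E₂) (ν₃ : Measure E₃)
    [IsProbabilityMeasure ν₁] [IsProbabilityMeasure ν₂] [IsProbabilityMeasure ν₃]
    {H : (n a b : ℕ) → (Fin n → E₁) → (Fin a → E₂) → (Fin b → E₃) → ℝ≥0∞}
    (hH : ∀ n a b, Measurable fun q : (((Fin b → E₃) × (Fin a → E₂)) × (Fin n → E₁)) =>
      H n a b q.2 q.1.2 q.1.1) :
    ∫⁻ q, H q.1.1 q.2.1.1 q.2.2.1 (fun i => q.1.2 i) (fun i => q.2.1.2 i) (fun i => q.2.2.2 i)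
        ∂(poissonSampleLaw r₁ ν₁).prod ((poissonSampleLaw r₂ ν₂).prod (poissonSampleLaw r₃ ν₃)) =
      ENNReal.ofReal (Real.exp (-r₁) * Real.exp (-r₂) * Real.exp (-r₃)) *
        expSum (r₃ • ν₃) fun b x => expSum (r₂ • ν₂) fun a y => expSum (r₁ • ν₁) fun n p =>
          H n a b p y x := by
  have hm : Measurable fun q : (ℕ × (ℕ → E₁)) × (ℕ × (ℕ → E₂)) × (ℕ × (ℕ → E₃)) =>
      H q.1.1 q.2.1.1 q.2.2.1 (fun i => q.1.2 i) (fun i => q.2.1.2 i) (fun i => q.2.2.2 i) := by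
    have he : Measurable fun q : (ℕ × (ℕ → E₁)) × (ℕ × (ℕ → E₂)) × (ℕ × (ℕ → E₃)) =>
        ((q.1.1, q.2.1.1, q.2.2.1), (q.1.2, q.2.1.2, q.2.2.2)) := by fun_prop
    have hg : Measurable fun c : (ℕ × ℕ × ℕ) × ((ℕ → E₁) × (ℕ → E₂) × (ℕ → E₃)) =>
        H c.1.1 c.1.2.1 c.1.2.2 (fun i => c.2.1 i) (fun i => c.2.2.1 i) fun i => c.2.2.2 i := by
      refine measurable_from_prod_countable_right fun c => ?_
      have hr : Measurable fun q : (ℕ → E₁) × (ℕ → E₂) × (ℕ → E₃) =>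
          (((fun i : Fin c.2.2 => q.2.2 i), fun i : Fin c.2.1 => q.2.1 i),
            fun i : Fin c.1 => q.1 i) := by fun_prop
      exact (hH c.1 c.2.1 c.2.2).comp hr
    exact hg.comp he
  have h1 : ∀ q₂ : ℕ × (ℕ → E₂), ∀ q₃ : ℕ × (ℕ → E₃),
      ∫⁻ q₁, H q₁.1 q₂.1 q₃.1 (fun i => q₁.2 i) (fun i => q₂.2 i) (fun i => q₃.2 i)
        ∂poissonSampleLaw r₁ ν₁ = ENNReal.ofReal (Real.exp (-r₁)) *
          expSum (r₁ • ν₁) fun n p => H n q₂.1 q₃.1 p (fun i => q₂.2 i) (fun i => q₃.2 i) :=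
    fun q₂ q₃ => lintegral_poissonSampleLaw r₁ ν₁
      (H := fun n p => H n q₂.1 q₃.1 p (fun i => q₂.2 i) fun i => q₃.2 i) fun n =>
        have hr : Measurable fun p : Fin n → E₁ =>
          (((fun i : Fin q₃.1 => q₃.2 i), fun i : Fin q₂.1 => q₂.2 i), p) := by fun_prop
        (hH n q₂.1 q₃.1).comp hr
  have hm1 : ∀ b a, Measurable fun q : (Fin b → E₃) × (Fin a → E₂) =>
      expSum (r₁ • ν₁) fun n p => H n a b p q.2 q.1 := fun b a =>
    measurable_expSum _ fun n => hH n a b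
  have h2 : ∀ q₃ : ℕ × (ℕ → E₃), ∫⁻ q₂, expSum (r₁ • ν₁)
      (fun n p => H n q₂.1 q₃.1 p (fun i => q₂.2 i) (fun i => q₃.2 i)) ∂poissonSampleLaw r₂ ν₂ =
        ENNReal.ofReal (Real.exp (-r₂)) * expSum (r₂ • ν₂) fun a y => expSum (r₁ • ν₁) fun n p =>
          H n a q₃.1 p y (fun i => q₃.2 i) := fun q₃ =>
    lintegral_poissonSampleLaw r₂ ν₂ (H := fun a y => expSum (r₁ • ν₁) fun n p =>
      H n a q₃.1 p y fun i => q₃.2 i) fun a => (hm1 q₃.1 a).comp measurable_prodMk_left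
  have h3 := lintegral_poissonSampleLaw r₃ ν₃ (H := fun b x => expSum (r₂ • ν₂) fun a y =>
    expSum (r₁ • ν₁) fun n p => H n a b p y x) fun b => measurable_expSum _ fun a => hm1 b a
  rw [lintegral_prod_symm _ hm.aemeasurable, lintegral_prod_symm _
    hm.lintegral_prod_left'.aemeasurable]
  simp_rw [h1, lintegral_const_mul' _ _ ENNReal.ofReal_ne_top, h2,
    lintegral_const_mul' _ _ ENNReal.ofReal_ne_top]
  rw [h3, ENNReal.ofReal_mul (by positivity), ENNReal.ofReal_mul (by positivity), mul_assoc,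
    mul_assoc]

end PoissonSamples

/-! ### The distribution of the longest path as a power series -/

section Distribution

open PowerSeries
open scoped ENNReal

lemma longestPath_range_le_iff {ι : Type*} [Finite ι] (p : ι → I × I) (l : ℕ) :
    longestPath (Set.range p) ≤ l ↔ ∀ s : Finset ι,
      ((∀ i ∈ s, ∀ j ∈ s, p i = p j → i = j) ∧ ∀ i ∈ s, ∀ j ∈ s, p i ≤ p j ∨ p j ≤ p i) →
        s.card ≤ l := by
  classical
  rw [longestPath_le_iff_forall (Set.finite_range p)]
  constructor
  · rintro h s ⟨hinj, hc⟩
    rw [← Finset.card_image_of_injOn (s := s) (f := p) fun i hi j hj => hinj i hi j hj]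
    refine h _ ?_ ?_
    · rw [Finset.coe_image]
      exact Set.image_subset_range _ _
    · intro a ha b hb _
      obtain ⟨i, hi, rfl⟩ := Finset.mem_image.1 (Finset.mem_coe.1 ha)
      obtain ⟨j, hj, rfl⟩ := Finset.mem_image.1 (Finset.mem_coe.1 hb)
      exact hc i hi j hj
  · intro h s hs hc
    rcases s.eq_empty_or_nonempty with rfl | ⟨a₀, ha₀⟩
    · simp
    have : Nonempty ι := ⟨(hs ha₀).choose⟩
    choose! f hf using fun a (ha : a ∈ s) => hs ha
    have hinj : Set.InjOn f s := fun a ha b hb hab => by rw [← hf a ha, ← hf b hb, hab]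
    rw [← Finset.card_image_of_injOn hinj]
    refine h _ ⟨?_, ?_⟩
    · intro i hi j hj hij
      obtain ⟨a, ha, rfl⟩ := Finset.mem_image.1 hi
      obtain ⟨b, hb, rfl⟩ := Finset.mem_image.1 hj
      rw [hf a ha, hf b hb] at hij
      rw [hij]
    · intro i hi j hj
      obtain ⟨a, ha, rfl⟩ := Finset.mem_image.1 hi
      obtain ⟨b, hb, rfl⟩ := Finset.mem_image.1 hj
      rw [hf a ha, hf b hb]
      exact hc.total ha hb

lemma measurableSet_longestPath_le {X ι : Type*} [MeasurableSpace X] [Finite ι]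
    {p : X → ι → I × I} (hp : ∀ i, Measurable fun x => p x i) (l : ℕ) :
    MeasurableSet {x | longestPath (Set.range (p x)) ≤ l} := by
  have : {x | longestPath (Set.range (p x)) ≤ l} = ⋂ s : Finset ι, ⋂ (_ : ¬ s.card ≤ l),
      ((⋂ i ∈ s, ⋂ j ∈ s, ⋂ (_ : i ≠ j), {x | p x i = p x j}ᶜ) ∩
        ⋂ i ∈ s, ⋂ j ∈ s, ({x | p x i ≤ p x j} ∪ {x | p x j ≤ p x i}))ᶜ := by
    ext x
    rw [Set.mem_ofPred_eq, longestPath_range_le_iff]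
    simp only [Set.mem_iInter, Set.mem_compl_iff, Set.mem_inter_iff, Set.mem_union,
      Set.mem_ofPred_eq]
    refine forall_congr' fun s => ?_
    rw [not_imp_not]
    refine imp_congr (and_congr ?_ Iff.rfl) Iff.rfl
    exact forall₄_congr fun i _ j _ =>
      ⟨fun h hne heq => hne (h heq), fun h heq => by_contra fun hne => h hne heq⟩
  rw [this]
  have : Countable ι := Finite.to_countable
  refine MeasurableSet.iInter fun s => MeasurableSet.iInter fun _ => MeasurableSet.compl ?_
  refine MeasurableSet.inter ?_ ?_
  · exact MeasurableSet.iInter fun i => MeasurableSet.iInter fun _ => MeasurableSet.iInter fun j =>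
      MeasurableSet.iInter fun _ => MeasurableSet.iInter fun _ =>
        (measurableSet_eq_fun (hp i) (hp j)).compl
  · exact MeasurableSet.iInter fun i => MeasurableSet.iInter fun _ => MeasurableSet.iInter fun j =>
      MeasurableSet.iInter fun _ =>
        (measurableSet_le (hp i) (hp j)).union (measurableSet_le (hp j) (hp i))

open scoped Classical in
/-- The indicator of the event that the longest path of `S` has at most `l` points. -/
def pathIndicator (l : ℕ) (S : Set (I × I)) : ℝ≥0∞ :=
  if longestPath S ≤ l then 1 else 0

lemma measurable_pathIndicator_range {X ι : Type*} [MeasurableSpace X] [Finite ι]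
    {p : X → ι → I × I} (hp : ∀ i, Measurable fun x => p x i) (l : ℕ) :
    Measurable fun x => pathIndicator l (Set.range (p x)) := by
  unfold pathIndicator
  exact Measurable.ite (measurableSet_longestPath_le hp l) measurable_const measurable_const

lemma measurable_pathIndicator_union {X ι ι' : Type*} [MeasurableSpace X] [Finite ι] [Finite ι']
    {p : X → ι → I × I} {q : X → ι' → I × I} (hp : ∀ i, Measurable fun x => p x i)
    (hq : ∀ i, Measurable fun x => q x i) (l : ℕ) :
    Measurable fun x => pathIndicator l (Set.range (p x) ∪ Set.range (q x)) := by
  simp_rw [← Set.Sum.elim_range]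
  refine measurable_pathIndicator_range (fun i => ?_) l
  rcases i with i | i
  · exact hp i
  · exact hq i

lemma measurable_pathIndicator_union₃ {X ι ι' ι'' : Type*} [MeasurableSpace X] [Finite ι]
    [Finite ι'] [Finite ι''] {p : X → ι → I × I} {q : X → ι' → I × I} {r : X → ι'' → I × I}
    (hp : ∀ i, Measurable fun x => p x i) (hq : ∀ i, Measurable fun x => q x i)
    (hr : ∀ i, Measurable fun x => r x i) (l : ℕ) :
    Measurable fun x =>
      pathIndicator l (Set.range (p x) ∪ Set.range (q x) ∪ Set.range (r x)) := by
  simp_rw [← Set.Sum.elim_range (p _) (q _)]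
  refine measurable_pathIndicator_union (fun i => ?_) hr l
  rcases i with i | i
  · exact hp i
  · exact hq i

/-- The probability of the event, with the points of the three Poisson processes integrated one
after the other. -/
lemma hammersleySourceLaw_eq_expSum (t αp αm : ℝ≥0) (l : ℕ) :
    MeasurableSet {q : (ℕ × (ℕ → I × I)) × (ℕ × (ℕ → I)) × (ℕ × (ℕ → I)) |
        longestPath (sourcePoints q.1 q.2.1 q.2.2) ≤ l} ∧
      hammersleySourceLaw t αp αm {q | longestPath (sourcePoints q.1 q.2.1 q.2.2) ≤ l} =
        ENNReal.ofReal (Real.exp (-((αp : ℝ) + αm) * t - t ^ 2)) *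
          expSum ((αm * t) • (volume : Measure I)) fun _ x =>
            expSum ((αp * t) • (volume : Measure I)) fun _ y =>
              expSum ((t ^ 2) • (volume : Measure (I × I))) fun _ p =>
                pathIndicator l (Set.range p ∪ Set.range (fun i => ((0 : I), y i)) ∪
                  Set.range fun i => (x i, (0 : I))) := by
  have hsrc : ∀ (q₁ : ℕ × (ℕ → I × I)) (q₂ q₃ : ℕ × (ℕ → I)), sourcePoints q₁ q₂ q₃ =
      Set.range (fun i : Fin q₁.1 => q₁.2 i) ∪ Set.range (fun i : Fin q₂.1 => ((0 : I), q₂.2 i)) ∪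
        Set.range fun i : Fin q₃.1 => (q₃.2 i, (0 : I)) := by
    intro q₁ q₂ q₃
    have h : ∀ (n : ℕ) (f : ℕ → I × I),
        {p | ∃ i < n, p = f i} = Set.range fun i : Fin n => f i := by
      intro n f
      ext p
      constructor
      · rintro ⟨i, hi, rfl⟩
        exact ⟨⟨i, hi⟩, rfl⟩
      · rintro ⟨i, rfl⟩
        exact ⟨i, i.2, rfl⟩
    rw [sourcePoints, h, h _ fun i => ((0 : I), q₂.2 i), h _ fun i => (q₃.2 i, (0 : I))]
  set f : (ℕ × (ℕ → I × I)) × (ℕ × (ℕ → I)) × (ℕ × (ℕ → I)) → ℝ≥0∞ := fun q =>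
    pathIndicator l (sourcePoints q.1 q.2.1 q.2.2) with hf
  set A : Set ((ℕ × (ℕ → I × I)) × (ℕ × (ℕ → I)) × (ℕ × (ℕ → I))) :=
    {q | longestPath (sourcePoints q.1 q.2.1 q.2.2) ≤ l} with hA
  have hev : ∀ {E : Type} [MeasurableSpace E] (i : ℕ), Measurable fun q : ℕ × (ℕ → E) => q.2 i :=
    fun i => (measurable_pi_apply i).comp measurable_snd
  have hAm : MeasurableSet A := by
    have : A = ⋃ n : ℕ, ⋃ a : ℕ, ⋃ b : ℕ, {q | q.1.1 = n} ∩ {q | q.2.1.1 = a} ∩ {q | q.2.2.1 = b} ∩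
        {q | longestPath (Set.range (Sum.elim (Sum.elim (fun i : Fin n => q.1.2 i)
          fun i : Fin a => ((0 : I), q.2.1.2 i)) fun i : Fin b => (q.2.2.2 i, (0 : I)))) ≤ l} := by
      ext q
      simp [hA, hsrc, Set.Sum.elim_range]
    rw [this]
    refine MeasurableSet.iUnion fun n => MeasurableSet.iUnion fun a => MeasurableSet.iUnion fun b =>
      MeasurableSet.inter (MeasurableSet.inter (MeasurableSet.inter ?_ ?_) ?_) ?_
    · exact (measurable_fst.comp measurable_fst) (measurableSet_singleton n)
    · exact (measurable_fst.comp (measurable_fst.comp measurable_snd)) (measurableSet_singleton a)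
    · exact (measurable_fst.comp (measurable_snd.comp measurable_snd)) (measurableSet_singleton b)
    · refine measurableSet_longestPath_le (fun i => ?_) l
      rcases i with (i | i) | i
      · exact (hev i).comp measurable_fst
      · exact measurable_const.prodMk ((hev i).comp (measurable_fst.comp measurable_snd))
      · exact ((hev i).comp (measurable_snd.comp measurable_snd)).prodMk measurable_const
  refine ⟨hAm, ?_⟩
  have hfA : f = A.indicator 1 := by
    ext q
    simp [hf, hA, pathIndicator, Set.indicator_apply]
  have h3 := lintegral_poissonSampleLaw₃ (t ^ 2) (αp * t) (αm * t) (volume : Measure (I × I))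
    (volume : Measure I) (volume : Measure I) (H := fun n a b p y x => pathIndicator l
      (Set.range p ∪ Set.range (fun i : Fin a => ((0 : I), y i)) ∪
        Set.range fun i : Fin b => (x i, (0 : I)))) fun n a b =>
    measurable_pathIndicator_union₃ (fun i => by fun_prop) (fun i => by fun_prop)
      (fun i => by fun_prop) l
  rw [← lintegral_indicator_one hAm, ← hfA, hammersleySourceLaw, hf]
  simp_rw [hsrc]
  rw [h3, ← Real.exp_add, ← Real.exp_add]
  congr 3
  push_cast
  ring

lemma factorial_mul_volume_strictMono (N : ℕ) :
    (N ! : ℝ≥0∞) * Measure.pi (fun _ : Fin N => (volume : Measure I)) {y | StrictMono y} = 1 := by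
  have h := lintegral_eq_factorial_mul_lintegral_strictMono (N := N) (volume : Measure I)
    (key := id) measurable_id (ae_injective_pi volume N) (f := fun _ => 1) measurable_const
    fun _ _ => rfl
  have hset : {p : Fin N → I | StrictMono fun i => id (p i)} = {y | StrictMono y} := rfl
  rw [hset, setLIntegral_const, one_mul, lintegral_const, one_mul, measure_univ] at h
  exact h.symm

lemma nonneg_coeff_det_stateMatrix (t a : ℝ≥0) (N : ℕ) {l : ℕ} {z : Fin l → ℝ} (hz : Monotone z)
    (h0 : ∀ i, 0 ≤ z i) : 0 ≤ coeff N (stateMatrix t a z).det := by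
  have h := measureReal_nonneg (μ := Measure.pi fun _ : Fin N => abscissaMeasure t a)
    (s := {v | Survives N z v})
  rw [pi_survives t a N hz h0] at h
  exact nonneg_of_mul_nonneg_right h (by positivity)

lemma bottomState_nonneg (l : ℕ) {b : ℕ} (x : Fin b → I) (i : Fin l) : 0 ≤ bottomState l x i := by
  unfold bottomState
  split_ifs
  · exact (x _).2.1
  · exact zero_le_two

lemma ae_pi_prod_of_ae_snd (ν : Measure I) [IsFiniteMeasure ν] (N : ℕ) {q : (Fin N → I) → Prop}
    (hq : ∀ᵐ y ∂Measure.pi (fun _ : Fin N => (volume : Measure I)), q y) :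
    ∀ᵐ p ∂Measure.pi (fun _ : Fin N => ν.prod (volume : Measure I)), q fun i => (p i).2 := by
  have h1 := (Measure.quasiMeasurePreserving_snd (μ := Measure.pi fun _ : Fin N => ν)
    (ν := Measure.pi fun _ : Fin N => (volume : Measure I))).ae hq
  exact (measurePreserving_arrowProdEquivProdArrow I I (Fin N) (fun _ => ν)
    (fun _ => (volume : Measure I))).quasiMeasurePreserving.ae h1

lemma ae_pos_pi (N : ℕ) :
    ∀ᵐ y ∂Measure.pi (fun _ : Fin N => (volume : Measure I)), ∀ i, 0 < y i := by
  refine ae_all_iff.2 fun i => ?_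
  refine (Measure.tendsto_eval_ae_ae (μ := fun _ : Fin N => (volume : Measure I))
    (i := i)).eventually ?_
  filter_upwards [compl_mem_ae_iff.2 (measure_singleton (0 : I))] with u hu
  exact lt_of_le_of_ne u.2.1 (Ne.symm hu)

/-- Points with increasing ordinates are admissible if the sequence of their abscissas survives. -/
lemma pathIndicator_of_strictMono_snd (l : ℕ) {N b : ℕ} {x : Fin b → I} (hx : StrictMono x)
    {p : Fin N → I × I} (hp0 : ∀ i, 0 < (p i).2) (hp : StrictMono fun i => (p i).2) :
    pathIndicator l (Set.range p ∪ Set.range fun k => (x k, (0 : I))) =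
      {p : Fin N → I × I |
        b ≤ l ∧ Survives N (bottomState l x) fun i => (p i).1}.indicator 1 p := by
  have hfin : (Set.range p ∪ Set.range fun k => (x k, (0 : I))).Finite :=
    (Set.finite_range _).union (Set.finite_range _)
  have hiff : longestPath (Set.range p ∪ Set.range fun k => (x k, (0 : I))) ≤ l ↔
      b ≤ l ∧ Survives N (bottomState l x) fun i => (p i).1 := by
    rw [longestPath_le_iff hfin, pathsFit_bottom_union_iff hx (by rintro _ ⟨i, rfl⟩; exact hp0 i),
      pathsFit_range_iff (monotone_bottomState l hx) p hp]
  by_cases h : b ≤ l ∧ Survives N (bottomState l x) fun i => (p i).1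
  · rw [pathIndicator, if_pos (hiff.2 h), Set.indicator_of_mem (s := {p : Fin N → I × I |
      b ≤ l ∧ Survives N (bottomState l x) fun i => (p i).1}) h, Pi.one_apply]
  · rw [pathIndicator, if_neg (mt hiff.1 h), Set.indicator_of_notMem (s := {p : Fin N → I × I |
      b ≤ l ∧ Survives N (bottomState l x) fun i => (p i).1}) h]

lemma pi_survives_inter_strictMono (t a : ℝ≥0) {l : ℕ} (N : ℕ) {z : Fin l → ℝ} (hz : Monotone z)
    (h0 : ∀ i, 0 ≤ z i) :
    Measure.pi (fun _ : Fin N => (t • abscissaMeasure t a).prod (volume : Measure I))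
      ({p | Survives N z fun i => (p i).1} ∩ {p | StrictMono fun i => (p i).2}) =
    ENNReal.ofReal (t ^ N * (N ! * coeff N (stateMatrix t a z).det)) *
      Measure.pi (fun _ : Fin N => (volume : Measure I)) {y | StrictMono y} := by
  have hmp := measurePreserving_arrowProdEquivProdArrow I I (Fin N)
    (fun _ => t • abscissaMeasure t a) (fun _ => (volume : Measure I))
  have hpre : {p : Fin N → I × I | Survives N z fun i => (p i).1} ∩
      {p | StrictMono fun i => (p i).2} = MeasurableEquiv.arrowProdEquivProdArrow I I (Fin N) ⁻¹'
        ({v | Survives N z v} ×ˢ {y | StrictMono y}) := rfl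
  have hSM : MeasurableSet {y : Fin N → I | StrictMono y} := measurableSet_strictMono measurable_id
  rw [hpre, hmp.measure_preimage ((measurableSet_survives_right N z).prod hSM).nullMeasurableSet,
    Measure.prod_prod, pi_smul_eq, Measure.smul_apply, ENNReal.smul_def, smul_eq_mul,
    ← ofReal_measureReal, pi_survives t a N hz h0,
    ENNReal.ofReal_mul (p := (t : ℝ) ^ N) (by positivity), ← NNReal.coe_pow,
    ENNReal.ofReal_coe_nnreal]

/-- For fixed bottom sources, the points above the bottom edge may be sorted by their ordinates, and
then only the sequence of their abscissas matters. -/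
lemma lintegral_pathIndicator (t a : ℝ≥0) (l N : ℕ) {b : ℕ} {x : Fin b → I} (hx : StrictMono x) :
    ∫⁻ p, pathIndicator l (Set.range p ∪ Set.range fun k => (x k, (0 : I)))
        ∂Measure.pi (fun _ : Fin N => (t • abscissaMeasure t a).prod (volume : Measure I)) =
      if b ≤ l then N ! * ENNReal.ofReal
        (t ^ N * coeff N (stateMatrix t a (bottomState l x)).det) else 0 := by
  have hSM := measurableSet_strictMono
    (by fun_prop : Measurable fun (p : Fin N → I × I) (i : Fin N) => (p i).2)
  have hmeas : Measurable fun p : Fin N → I × I =>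
      pathIndicator l (Set.range p ∪ Set.range fun k => (x k, (0 : I))) :=
    measurable_pathIndicator_union (q := fun _ k => (x k, (0 : I)))
      (fun i => measurable_pi_apply i) (fun _ => measurable_const) l
  rw [lintegral_eq_factorial_mul_lintegral_strictMono _ measurable_snd
    (ae_pi_prod_of_ae_snd _ N (ae_injective_pi volume N)) hmeas
    fun e p => by rw [e.surjective.range_comp]]
  have hcongr := lintegral_congr_ae
    (μ := (Measure.pi fun _ : Fin N => (t • abscissaMeasure t a).prod (volume : Measure I)).restrict
      {p | StrictMono fun i => (p i).2})
    (f := fun p => pathIndicator l (Set.range p ∪ Set.range fun k => (x k, (0 : I))))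
    (by
      filter_upwards [ae_restrict_of_ae (ae_pi_prod_of_ae_snd _ N (ae_pos_pi N)),
        ae_restrict_mem hSM] with p hp0 hp
      exact pathIndicator_of_strictMono_snd l hx hp0 hp)
  rw [hcongr]
  split_ifs with hbl
  · have hS : MeasurableSet {p : Fin N → I × I | Survives N (bottomState l x) fun i => (p i).1} :=
      (measurableSet_survives_right N (bottomState l x)).preimage
        (by fun_prop : Measurable fun (p : Fin N → I × I) i => (p i).1)
    have hN : 0 ≤ (N ! : ℝ) := by positivity
    simp only [hbl, true_and]
    rw [lintegral_indicator_one hS, Measure.restrict_apply hS,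
      pi_survives_inter_strictMono t a N (monotone_bottomState l hx) (bottomState_nonneg l x),
      mul_left_comm, factorial_mul_volume_strictMono, mul_one, mul_left_comm,
      ENNReal.ofReal_mul hN, ENNReal.ofReal_natCast]
  · simp [hbl]

/-- The points inside the square and the sources on the left edge form one Poisson process, whose
intensity is a product measure. -/
lemma expSum_left_bulk (t a : ℝ≥0) (l : ℕ) {b : ℕ} (x : Fin b → I) :
    (expSum ((a * t) • (volume : Measure I)) fun _ y =>
      expSum ((t ^ 2) • (volume : Measure (I × I))) fun _ p =>
        pathIndicator l (Set.range p ∪ Set.range (fun i => ((0 : I), y i)) ∪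
          Set.range fun i => (x i, (0 : I)))) =
      expSum ((t • abscissaMeasure t a).prod (volume : Measure I)) fun _ p =>
        pathIndicator l (Set.range p ∪ Set.range fun i => (x i, (0 : I))) := by
  have hmeas : (t • abscissaMeasure t a).prod (volume : Measure I) =
      ((a * t) • (volume : Measure I)).map (Prod.mk (0 : I)) +
        (t ^ 2) • (volume : Measure (I × I)) := by
    rw [abscissaMeasure, smul_add, smul_smul, smul_smul, Measure.add_prod, add_comm, mul_comm t a,
      Measure.map_smul, ← Measure.dirac_prod, Measure.prod_smul_left, Measure.prod_smul_left,
      ← sq, Measure.volume_eq_prod]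
  have hfin : IsFiniteMeasure (((a * t) • (volume : Measure I)).map (Prod.mk (0 : I))) :=
    Measure.isFiniteMeasure_map _ _
  rw [hmeas, expSum_add (Φ := fun S => pathIndicator l (S ∪ Set.range fun i => (x i, (0 : I))))
    _ _ fun k j => measurable_pathIndicator_union₃ (fun i => by fun_prop) (fun i => by fun_prop)
      (fun i => by fun_prop) l, expSum_map _ measurable_prodMk_left]
  · simp_rw [Set.union_comm (Set.range fun i => ((0 : I), _))]
  · exact fun n => measurable_expSum _ fun j => measurable_pathIndicator_union₃
      (fun i => by fun_prop) (fun i => by fun_prop) (fun i => by fun_prop) l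

/-- The distribution function of the longest path, as a power series. -/
theorem hammersleySourceLaw_eq_tsum (t a b : ℝ≥0) (l : ℕ) :
    (∀ N, 0 ≤ coeff N ((edgeMatrix t a b l).det -
      C ((a : ℝ) * b) * if l = 0 then 0 else (edgeMatrix t a b (l - 1)).det)) ∧
    hammersleySourceLaw t a b {q | longestPath (sourcePoints q.1 q.2.1 q.2.2) ≤ l} =
      ENNReal.ofReal (Real.exp (-((a : ℝ) + b) * t - t ^ 2)) *
        ∑' N : ℕ, ENNReal.ofReal (t ^ N * coeff N ((edgeMatrix t a b l).det -
          C ((a : ℝ) * b) * if l = 0 then 0 else (edgeMatrix t a b (l - 1)).det)) := by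
  have hpos : ∀ N c, ∀ x ∈ {x : Fin c → I | StrictMono x},
      0 ≤ coeff N (stateMatrix t a (bottomState l x)).det := fun N c x hx =>
    nonneg_coeff_det_stateMatrix t a N (monotone_bottomState l hx) (bottomState_nonneg l x)
  have hSM : ∀ c, MeasurableSet {x : Fin c → I | StrictMono x} := fun c =>
    measurableSet_strictMono measurable_id
  have hposint : ∀ N c, 0 ≤ (b : ℝ) ^ c * ∫ x in {x : Fin c → I | StrictMono x},
      coeff N (stateMatrix t a (bottomState l x)).det
        ∂Measure.pi (fun _ => (t • volume : Measure I)) := fun N c =>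
    mul_nonneg (by positivity) (setIntegral_nonneg (hSM c) (hpos N c))
  refine ⟨fun N => ?_, ?_⟩
  · rw [← sum_integral_bottomState]
    exact Finset.sum_nonneg fun c _ => hposint N c
  rw [(hammersleySourceLaw_eq_expSum t a b l).2]
  congr 1
  simp_rw [expSum_left_bulk]
  -- The bottom sources may be sorted by their abscissas.
  have hsort : ∀ c : ℕ, (c ! : ℝ≥0∞)⁻¹ * ∫⁻ x,
      (expSum ((t • abscissaMeasure t a).prod (volume : Measure I)) fun _ p =>
        pathIndicator l (Set.range p ∪ Set.range fun i : Fin c => (x i, (0 : I))))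
          ∂Measure.pi (fun _ => ((b * t) • volume : Measure I)) =
      if c ≤ l then (b : ℝ≥0∞) ^ c * ∑' N : ℕ, ENNReal.ofReal (t ^ N *
        ∫ x in {x : Fin c → I | StrictMono x}, coeff N (stateMatrix t a (bottomState l x)).det
          ∂Measure.pi (fun _ => (t • volume : Measure I))) else 0 := by
    intro c
    have h0 : (c ! : ℝ≥0∞) ≠ 0 := by exact_mod_cast c.factorial_ne_zero
    have hm : Measurable fun x : Fin c → I =>
        expSum ((t • abscissaMeasure t a).prod (volume : Measure I)) fun _ p =>
          pathIndicator l (Set.range p ∪ Set.range fun i : Fin c => (x i, (0 : I))) :=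
      measurable_expSum _ fun N => measurable_pathIndicator_union (fun i => by fun_prop)
        (fun i => by fun_prop) l
    have hinj : ∀ᵐ x ∂Measure.pi (fun _ : Fin c => ((b * t) • volume : Measure I)),
        Function.Injective fun i => id (x i) := by
      rw [pi_smul_eq]
      exact Measure.ae_smul_measure (ae_injective_pi volume c) _
    rw [lintegral_eq_factorial_mul_lintegral_strictMono (key := id) _ measurable_id hinj hm
      fun e x => ?_, ← mul_assoc, ENNReal.inv_mul_cancel h0 (ENNReal.natCast_ne_top _), one_mul]
    swap
    · have : ∀ S : Set (I × I), S ∪ Set.range (fun i => ((x ∘ e) i, (0 : I))) =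
          S ∪ Set.range fun i => (x i, (0 : I)) := fun S => by
        rw [← e.surjective.range_comp fun i => (x i, (0 : I))]
        rfl
      simp_rw [this]
    have hset : {x : Fin c → I | StrictMono fun i => id (x i)} = {x | StrictMono x} := rfl
    rw [hset]
    have hin : ∀ x ∈ {x : Fin c → I | StrictMono x},
        (expSum ((t • abscissaMeasure t a).prod (volume : Measure I)) fun _ p =>
          pathIndicator l (Set.range p ∪ Set.range fun i : Fin c => (x i, (0 : I)))) =
        if c ≤ l then ∑' N : ℕ, ENNReal.ofReal
          (t ^ N * coeff N (stateMatrix t a (bottomState l x)).det) else 0 := by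
      intro x hx
      rw [expSum, tsum_congr fun N => by rw [lintegral_pathIndicator t a l N hx]]
      split_ifs with hcl
      · refine tsum_congr fun N => ?_
        rw [← mul_assoc, ENNReal.inv_mul_cancel (by exact_mod_cast N.factorial_ne_zero)
          (ENNReal.natCast_ne_top _), one_mul]
      · simp
    rw [setLIntegral_congr_fun (hSM c) hin]
    split_ifs with hcl
    · have hbc := fun N => (boundedCoeffs_det_mixedMatrix (t : ℝ) a b l
        (measurable_bottomState l c)) N
      simp_rw [mixedMatrix_of_le (t : ℝ) a b le_rfl] at hbc
      rw [mul_smul, pi_smul_eq, Measure.restrict_smul, lintegral_smul_measure, ENNReal.smul_def,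
        smul_eq_mul, ENNReal.coe_pow, lintegral_tsum fun N =>
          ((hbc N).1.const_mul _).ennreal_ofReal.aemeasurable]
      congr 1
      refine tsum_congr fun N => ?_
      rw [← integral_const_mul, ofReal_integral_eq_lintegral_ofReal]
      · obtain ⟨hmN, B, hB⟩ := hbc N
        exact (Integrable.of_bound hmN.aestronglyMeasurable B
          (Filter.Eventually.of_forall hB)).const_mul _
      · refine (ae_restrict_iff' (hSM c)).2 (Filter.Eventually.of_forall fun x hx => ?_)
        exact mul_nonneg (by positivity) (hpos N c x hx)
    · simp
  rw [expSum, tsum_congr hsort, tsum_eq_sum (s := Finset.range (l + 1)) fun c hc => by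
    rw [if_neg]; simpa [Nat.lt_succ_iff] using hc]
  simp_rw [← ENNReal.tsum_mul_left]
  rw [Finset.sum_congr rfl fun c hc => by
    rw [if_pos (Nat.lt_succ_iff.1 (Finset.mem_range.1 hc))]]
  rw [← Summable.tsum_finsetSum fun _ _ => ENNReal.summable]
  refine tsum_congr fun N => ?_
  rw [← sum_integral_bottomState, Finset.mul_sum, ENNReal.ofReal_sum_of_nonneg fun c _ =>
    mul_nonneg (by positivity) (hposint N c)]
  refine Finset.sum_congr rfl fun c _ => ?_
  rw [mul_left_comm, ENNReal.ofReal_mul (p := (b : ℝ) ^ c) (by positivity), ← NNReal.coe_pow b,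
    ENNReal.ofReal_coe_nnreal, ENNReal.coe_pow]

end Distribution

/-! ### Evaluation of absolutely convergent power series -/

section Evaluation

open PowerSeries

/-- The power series that converge absolutely at `t`. -/
def convergentSubring (t : ℝ) : Subring ℝ⟦X⟧ where
  carrier := {f | Summable fun n => ‖coeff n f * t ^ n‖}
  mul_mem' {f g} hf hg := by
    refine (summable_norm_sum_mul_antidiagonal_of_summable_norm hf hg).congr fun n => ?_
    rw [coeff_mul, Finset.sum_mul]
    refine congrArg _ (Finset.sum_congr rfl fun p hp => ?_)
    rw [← Finset.HasAntidiagonal.mem_antidiagonal.1 hp, pow_add, mul_mul_mul_comm]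
  one_mem' := summable_of_ne_finset_zero (s := {0}) fun n hn => by
    rw [coeff_one, if_neg (by simpa using hn), zero_mul, norm_zero]
  add_mem' {f g} hf hg := by
    refine (hf.add hg).of_nonneg_of_le (fun n => norm_nonneg _) fun n => ?_
    rw [map_add, add_mul]
    exact norm_add_le _ _
  zero_mem' := by simp [summable_zero]
  neg_mem' {f} hf := by simpa using hf

/-- The value at `t` of a power series that converges absolutely there. -/
def convergentEval (t : ℝ) : convergentSubring t →+* ℝ where
  toFun f := ∑' n, coeff n (f : ℝ⟦X⟧) * t ^ n
  map_mul' f g := by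
    rw [tsum_mul_tsum_eq_tsum_sum_antidiagonal_of_summable_norm f.2 g.2]
    refine tsum_congr fun n => ?_
    rw [Subring.coe_mul, coeff_mul, Finset.sum_mul]
    refine Finset.sum_congr rfl fun p hp => ?_
    rw [← Finset.HasAntidiagonal.mem_antidiagonal.1 hp, pow_add, mul_mul_mul_comm]
  map_one' := by
    rw [tsum_eq_single 0 fun n hn => by rw [Subring.coe_one, coeff_one, if_neg hn, zero_mul]]
    simp
  map_add' f g := by
    rw [← f.2.of_norm.tsum_add g.2.of_norm]
    exact tsum_congr fun n => by rw [Subring.coe_add, map_add, add_mul]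
  map_zero' := by simp

lemma hasSum_coeff_det {n : Type*} [Fintype n] [DecidableEq n] (t : ℝ) {M : Matrix n n ℝ⟦X⟧}
    {A : Matrix n n ℝ} (h : ∀ i j, HasSum (fun k => coeff k (M i j) * t ^ k) (A i j)) :
    HasSum (fun k => coeff k M.det * t ^ k) A.det := by
  have hM : ∀ i j, M i j ∈ convergentSubring t := fun i j => (h i j).summable.norm
  set M' : Matrix n n (convergentSubring t) := Matrix.of fun i j => ⟨M i j, hM i j⟩ with hM'
  have h1 : M = (convergentSubring t).subtype.mapMatrix M' := rfl
  have h2 : A = (convergentEval t).mapMatrix M' := by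
    ext i j
    exact (h i j).tsum_eq.symm
  rw [h1, h2, ← RingHom.map_det, ← RingHom.map_det]
  exact (M'.det.2 : Summable fun k => ‖coeff k (M'.det : ℝ⟦X⟧) * t ^ k‖).of_norm.hasSum

end Evaluation

/-! ### Averages over the unitary group -/

section Heine

open Complex

lemma integral_exp_I_zpow (n : ℤ) :
    ∫ θ in Set.Ioc (-Real.pi) Real.pi, exp (Complex.I * θ) ^ n =
      if n = 0 then 2 * (Real.pi : ℂ) else 0 := by
  have hπ : -Real.pi ≤ Real.pi := by linarith [Real.pi_pos]
  rw [← intervalIntegral.integral_of_le hπ]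
  split_ifs with hn
  · simp [hn, two_mul]
  · have h : ∀ θ : ℝ, exp (Complex.I * θ) ^ n = exp ((n * Complex.I) * θ) := fun θ => by
      rw [← exp_int_mul, mul_assoc]
    have hc : (n : ℂ) * Complex.I ≠ 0 := mul_ne_zero (by exact_mod_cast hn) I_ne_zero
    simp_rw [h]
    rw [integral_exp_mul_complex hc]
    have : (n : ℂ) * Complex.I * (Real.pi : ℝ) =
        n * Complex.I * ((-Real.pi : ℝ) : ℂ) + n * (2 * Real.pi * Complex.I) := by
      push_cast; ring
    rw [this, exp_add, exp_int_mul_two_pi_mul_I, mul_one, sub_self, zero_div]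

/-- Expansion of an exponential under the integral. -/
lemma hasSum_integral_exp_mul {w g : ℝ → ℂ} (hw : Continuous w) (hg : Continuous g)
    (hw1 : ∀ θ, ‖w θ‖ = 1) (t : ℝ) :
    HasSum (fun k : ℕ => (t : ℂ) ^ k / k ! *
        ∫ θ in Set.Ioc (-Real.pi) Real.pi, w θ ^ k * g θ)
      (∫ θ in Set.Ioc (-Real.pi) Real.pi, exp (t * w θ) * g θ) := by
  simp_rw [← integral_const_mul]
  obtain ⟨C, hC⟩ := (isCompact_Icc (a := -Real.pi) (b := Real.pi)).exists_bound_of_continuousOn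
    hg.continuousOn
  have hC' : ∀ᵐ θ ∂(volume : Measure ℝ).restrict (Set.Ioc (-Real.pi) Real.pi), ‖g θ‖ ≤ C :=
    (ae_restrict_iff' measurableSet_Ioc).2
      (Filter.Eventually.of_forall fun θ hθ => hC θ (Set.Ioc_subset_Icc_self hθ))
  have hs : Summable fun k : ℕ => |t| ^ k / k ! * C :=
    (Real.summable_pow_div_factorial |t|).mul_right C
  refine hasSum_integral_of_dominated_convergence (fun k _ => |t| ^ k / k ! * C)
    (fun k => Continuous.aestronglyMeasurable (by fun_prop)) (fun k => ?_)
    (Filter.Eventually.of_forall fun _ => hs) (integrable_const _)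
    (Filter.Eventually.of_forall fun θ => ?_)
  · filter_upwards [hC'] with θ hθ
    rw [norm_mul, norm_mul, norm_pow, hw1, one_pow, one_mul, norm_div, norm_pow, norm_real,
      Real.norm_eq_abs, norm_natCast]
    gcongr
  · have h := (NormedSpace.expSeries_div_hasSum_exp ((t : ℂ) * w θ)).mul_right (g θ)
    rw [← Complex.exp_eq_exp_ℂ] at h
    refine h.congr_fun ?_
    intro k
    rw [mul_pow]; ring

lemma norm_exp_I_mul (θ : ℝ) : ‖exp (Complex.I * θ)‖ = 1 := by
  rw [mul_comm, norm_exp_ofReal_mul_I]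

lemma continuous_exp_I_zpow (n : ℤ) : Continuous fun θ : ℝ => exp (Complex.I * θ) ^ n := by
  refine Continuous.zpow₀ (by fun_prop) n fun θ => Or.inl (exp_ne_zero _)

lemma integral_exp_exp_I_mul_zpow (t : ℝ) (n : ℤ) :
    ∫ θ in Set.Ioc (-Real.pi) Real.pi, exp (t * exp (Complex.I * θ)) * exp (Complex.I * θ) ^ (-n) =
      2 * Real.pi * expCoeff n t := by
  have h := hasSum_integral_exp_mul (w := fun θ => exp (Complex.I * θ)) (by fun_prop)
    (continuous_exp_I_zpow (-n)) norm_exp_I_mul t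
  refine h.unique ?_
  have hk : ∀ k : ℕ, ∫ θ : ℝ in Set.Ioc (-Real.pi) Real.pi,
      exp (Complex.I * θ) ^ k * exp (Complex.I * θ) ^ (-n) =
        if (k : ℤ) = n then 2 * (Real.pi : ℂ) else 0 := by
    intro k
    simp_rw [← zpow_natCast, ← zpow_add₀ (exp_ne_zero _), integral_exp_I_zpow, ← sub_eq_add_neg,
      sub_eq_zero]
  simp_rw [hk]
  rcases lt_or_ge n 0 with hn | hn
  · rw [expCoeff_of_neg hn, ofReal_zero, mul_zero]
    convert hasSum_zero with k
    rw [if_neg (by omega), mul_zero]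
  · lift n to ℕ using hn
    have h1 : 2 * (Real.pi : ℂ) * expCoeff n t = (t : ℂ) ^ n / n ! * (2 * Real.pi) := by
      rw [expCoeff_natCast]; push_cast; ring
    rw [h1]
    convert hasSum_ite_eq n ((t : ℂ) ^ n / n ! * (2 * Real.pi)) using 2 with k
    by_cases hkn : k = n
    · simp [hkn]
    · simp [hkn]

lemma sourceCoeff_two (t a : ℝ) (n : ℤ) :
    sourceCoeff t a n 2 = expCoeff n t + a * expCoeff (n - 1) t := by
  rw [sourceCoeff, if_neg (by norm_num), min_eq_right one_le_two, mul_one]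

lemma integral_source_mul_zpow (t a : ℝ) (n : ℤ) :
    ∫ θ in Set.Ioc (-Real.pi) Real.pi, (1 + a * exp (Complex.I * θ)) *
      exp (t * exp (Complex.I * θ)) * exp (Complex.I * θ) ^ (-n) =
      2 * Real.pi * sourceCoeff t a n 2 := by
  have hz : ∀ n : ℤ, Integrable
      (fun θ : ℝ => exp (t * exp (Complex.I * θ)) * exp (Complex.I * θ) ^ (-n))
      (volume.restrict (Set.Ioc (-Real.pi) Real.pi)) := fun n => by
    have := continuous_exp_I_zpow (-n)
    exact Continuous.integrableOn_Ioc (by fun_prop)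
  have hexp : ∀ θ : ℝ, (1 + a * exp (Complex.I * θ)) *
      exp (t * exp (Complex.I * θ)) * exp (Complex.I * θ) ^ (-n) =
      exp (t * exp (Complex.I * θ)) * exp (Complex.I * θ) ^ (-n) +
        a * (exp (t * exp (Complex.I * θ)) * exp (Complex.I * θ) ^ (-(n - 1))) := by
    intro θ
    rw [neg_sub, sub_eq_neg_add, zpow_add_one₀ (exp_ne_zero _)]
    ring
  simp_rw [hexp]
  rw [integral_add (hz n) ((hz (n - 1)).const_mul _), integral_const_mul,
    integral_exp_exp_I_mul_zpow, integral_exp_exp_I_mul_zpow, sourceCoeff_two]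
  push_cast
  ring

/-- The weight of a single eigenvalue `exp (i θ)`. -/
def sourceSymbol (t a b θ : ℝ) : ℂ :=
  (1 + a * exp (Complex.I * θ)) * (1 + b * exp (-(Complex.I * θ))) * exp (2 * t * cos θ)

lemma continuous_sourceSymbol (t a b : ℝ) : Continuous (sourceSymbol t a b) := by
  unfold sourceSymbol
  fun_prop

/-- The Fourier coefficients of the symbol are the values of the series `edgeSeries` at `t`. -/
lemma hasSum_coeff_edgeSeries (t a b : ℝ) (d : ℤ) :
    HasSum (fun k => ((PowerSeries.coeff k (edgeSeries t a b d) * t ^ k : ℝ) : ℂ))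
      (1 / (2 * Real.pi) *
        ∫ θ in Set.Ioc (-Real.pi) Real.pi, sourceSymbol t a b θ * exp (Complex.I * θ) ^ (-d)) := by
  set g : ℝ → ℂ := fun θ => (1 + a * exp (Complex.I * θ)) * (1 + b * exp (-(Complex.I * θ))) *
    exp (t * exp (Complex.I * θ)) * exp (Complex.I * θ) ^ (-d) with hg
  have hgc : Continuous g := by
    have := continuous_exp_I_zpow (-d)
    fun_prop
  have h := (hasSum_integral_exp_mul (w := fun θ => exp (-(Complex.I * θ))) (by fun_prop) hgc
    (fun θ => by rw [exp_neg, norm_inv, norm_exp_I_mul, inv_one]) t).mul_left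
      (1 / (2 * Real.pi : ℂ))
  have hsymb : ∫ θ in Set.Ioc (-Real.pi) Real.pi,
      sourceSymbol t a b θ * exp (Complex.I * θ) ^ (-d) =
      ∫ θ in Set.Ioc (-Real.pi) Real.pi, exp (t * exp (-(Complex.I * θ))) * g θ := by
    refine setIntegral_congr_fun measurableSet_Ioc fun θ _ => ?_
    have : exp (2 * t * cos θ) =
        exp (t * exp (-(Complex.I * θ))) * exp (t * exp (Complex.I * θ)) := by
      rw [← exp_add, ← mul_add, add_comm (exp _), mul_right_comm, mul_comm Complex.I, ← neg_mul]
      rw [two_mul, ← mul_two, mul_right_comm]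
      congr 1
      rw [Complex.cos]; ring
    simp only [sourceSymbol, hg, this]
    ring
  rw [hsymb]
  refine h.congr_fun fun k => ?_
  have hz : ∀ n : ℤ, Integrable (fun θ : ℝ => (1 + a * exp (Complex.I * θ)) *
      exp (t * exp (Complex.I * θ)) * exp (Complex.I * θ) ^ (-n))
      (volume.restrict (Set.Ioc (-Real.pi) Real.pi)) := fun n => by
    have := continuous_exp_I_zpow (-n)
    exact Continuous.integrableOn_Ioc (by fun_prop)
  have hexp : ∀ θ : ℝ, exp (-(Complex.I * θ)) ^ k * g θ =
      (1 + a * exp (Complex.I * θ)) * exp (t * exp (Complex.I * θ)) *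
        exp (Complex.I * θ) ^ (-((k : ℤ) + d)) +
      b * ((1 + a * exp (Complex.I * θ)) * exp (t * exp (Complex.I * θ)) *
        exp (Complex.I * θ) ^ (-((k : ℤ) + (d + 1)))) := by
    intro θ
    have hne := exp_ne_zero (Complex.I * θ)
    have e1 : exp (Complex.I * θ) ^ (-((k : ℤ) + d)) =
        (exp (Complex.I * θ))⁻¹ ^ k * exp (Complex.I * θ) ^ (-d) := by
      rw [inv_pow, neg_add, zpow_add₀ hne, zpow_neg _ (k : ℤ), zpow_natCast]
    have e2 : exp (Complex.I * θ) ^ (-((k : ℤ) + (d + 1))) =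
        (exp (Complex.I * θ))⁻¹ ^ k * exp (Complex.I * θ) ^ (-d) * (exp (Complex.I * θ))⁻¹ := by
      rw [← e1, ← zpow_sub_one₀ hne]
      congr 1
      ring
    simp only [hg, e1, e2, exp_neg]
    ring
  simp_rw [hexp]
  rw [integral_add (hz _) ((hz _).const_mul _), integral_const_mul,
    integral_source_mul_zpow, integral_source_mul_zpow, edgeSeries, map_add,
    PowerSeries.coeff_C_mul, sourceSeries, sourceSeries, PowerSeries.coeff_mk, PowerSeries.coeff_mk]
  have hπ : (Real.pi : ℂ) ≠ 0 := by exact_mod_cast Real.pi_ne_zero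
  push_cast
  field_simp

lemma prod_norm_sub_sq_eq_det (l : ℕ) (θ : Fin l → ℝ) :
    ∏ j : Fin l, ∏ k ∈ Finset.Ioi j,
      ((‖exp (Complex.I * θ k) - exp (Complex.I * θ j)‖ ^ 2 : ℝ) : ℂ) =
    (Matrix.vandermonde fun j => exp (Complex.I * θ j)).det *
      (Matrix.vandermonde fun j => (exp (Complex.I * θ j))⁻¹).det := by
  rw [Matrix.det_vandermonde, Matrix.det_vandermonde, ← Finset.prod_mul_distrib]
  refine Finset.prod_congr rfl fun j _ => ?_
  rw [← Finset.prod_mul_distrib]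
  refine Finset.prod_congr rfl fun k _ => ?_
  have hc : ∀ x : ℝ, (exp (Complex.I * x))⁻¹ = (starRingEnd ℂ) (exp (Complex.I * x)) := fun x => by
    rw [← exp_conj, map_mul, conj_I, conj_ofReal, neg_mul, exp_neg]
  rw [hc, hc, ← map_sub, mul_conj, normSq_eq_norm_sq]

/-- Heine's identity: the average of a product is a Toeplitz determinant. -/
lemma unitaryAverage_prod (l : ℕ) {f : ℝ → ℂ} (hf : Continuous f) :
    unitaryAverage l (fun θ => ∏ j, f (θ j)) =
      (Matrix.of fun i j : Fin l => 1 / (2 * (Real.pi : ℂ)) *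
        ∫ θ in Set.Ioc (-Real.pi) Real.pi, f θ * exp (Complex.I * θ) ^ (-((j : ℤ) - i))).det := by
  set G : Matrix (Fin l) (Fin l) ℂ := Matrix.of fun i j =>
    ∫ θ in Set.Ioc (-Real.pi) Real.pi, f θ * exp (Complex.I * θ) ^ (-((j : ℤ) - i)) with hG
  have hsmul : (Matrix.of fun i j : Fin l => 1 / (2 * (Real.pi : ℂ)) *
      ∫ θ in Set.Ioc (-Real.pi) Real.pi, f θ * exp (Complex.I * θ) ^ (-((j : ℤ) - i))) =
      (1 / (2 * (Real.pi : ℂ))) • G := rfl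
  -- Leibniz' expansion of both Vandermonde determinants.
  have hexp : ∀ θ : Fin l → ℝ, (∏ j, f (θ j)) * ∏ j : Fin l, ∏ k ∈ Finset.Ioi j,
      ((‖exp (Complex.I * θ k) - exp (Complex.I * θ j)‖ ^ 2 : ℝ) : ℂ) =
      ∑ p : Equiv.Perm (Fin l), ∑ q : Equiv.Perm (Fin l),
        ((Equiv.Perm.sign p : ℤ) : ℂ) * ((Equiv.Perm.sign q : ℤ) : ℂ) *
          ∏ i, f (θ i) * exp (Complex.I * θ i) ^ (-((q i : ℤ) - p i)) := by
    intro θ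
    rw [prod_norm_sub_sq_eq_det, ← Matrix.det_transpose, ← Matrix.det_transpose
      (Matrix.vandermonde fun j => (exp (Complex.I * θ j))⁻¹), Matrix.det_apply', Matrix.det_apply',
      Finset.sum_mul_sum, Finset.mul_sum]
    refine Finset.sum_congr rfl fun p _ => ?_
    rw [Finset.mul_sum]
    refine Finset.sum_congr rfl fun q _ => ?_
    rw [Finset.prod_mul_distrib]
    have : ∀ i, exp (Complex.I * θ i) ^ (-((q i : ℤ) - p i)) =
        exp (Complex.I * θ i) ^ (p i : ℕ) * (exp (Complex.I * θ i))⁻¹ ^ (q i : ℕ) := fun i => by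
      rw [neg_sub, zpow_sub₀ (exp_ne_zero _), zpow_natCast, zpow_natCast, inv_pow, div_eq_mul_inv]
    simp_rw [this, Finset.prod_mul_distrib, Matrix.transpose_apply, Matrix.vandermonde_apply]
    ring
  have hint : ∀ p q : Equiv.Perm (Fin l), Integrable (fun θ : Fin l → ℝ =>
      ((Equiv.Perm.sign p : ℤ) : ℂ) * ((Equiv.Perm.sign q : ℤ) : ℂ) *
        ∏ i, f (θ i) * exp (Complex.I * θ i) ^ (-((q i : ℤ) - p i)))
      (volume.restrict (Set.univ.pi fun _ : Fin l => Set.Ioc (-Real.pi) Real.pi)) := by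
    intro p q
    rw [volume_pi, Measure.restrict_pi_pi]
    refine (Integrable.fintype_prod (f := fun i (x : ℝ) =>
      f x * exp (Complex.I * x) ^ (-((q i : ℤ) - p i))) fun i => ?_).const_mul _
    exact (hf.mul (continuous_exp_I_zpow _)).integrableOn_Ioc
  have hprod : ∀ p q : Equiv.Perm (Fin l),
      ∫ θ in Set.univ.pi fun _ : Fin l => Set.Ioc (-Real.pi) Real.pi,
        ((Equiv.Perm.sign p : ℤ) : ℂ) * ((Equiv.Perm.sign q : ℤ) : ℂ) *
          ∏ i, f (θ i) * exp (Complex.I * θ i) ^ (-((q i : ℤ) - p i)) =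
      ((Equiv.Perm.sign p : ℤ) : ℂ) * ((Equiv.Perm.sign q : ℤ) : ℂ) * ∏ i, G (p i) (q i) := by
    intro p q
    rw [integral_const_mul, volume_pi, Measure.restrict_pi_pi,
      integral_fintype_prod_eq_prod (f := fun i (x : ℝ) =>
        f x * exp (Complex.I * x) ^ (-((q i : ℤ) - p i)))]
    rfl
  -- For fixed `p` the sum over `q` is the determinant of `G` with permuted rows.
  have hdet : ∀ p : Equiv.Perm (Fin l), ∑ q : Equiv.Perm (Fin l),
      ((Equiv.Perm.sign p : ℤ) : ℂ) * ((Equiv.Perm.sign q : ℤ) : ℂ) * ∏ i, G (p i) (q i) =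
        G.det := by
    intro p
    simp_rw [mul_assoc]
    rw [← Finset.mul_sum]
    have h := Matrix.det_permute p G
    rw [← Matrix.det_transpose, Matrix.det_apply'] at h
    simp only [Matrix.transpose_apply, Matrix.submatrix_apply, id] at h
    rw [h, ← mul_assoc, ← Int.cast_mul, ← Units.val_mul, Int.units_mul_self, Units.val_one,
      Int.cast_one, one_mul]
  rw [unitaryAverage, hsmul, Matrix.det_smul, Fintype.card_fin]
  simp_rw [hexp]
  rw [integral_finsetSum _ fun p _ => integrable_finsetSum _ fun q _ => hint p q]
  simp_rw [integral_finsetSum _ fun q _ => hint _ q, hprod, hdet]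
  rw [Finset.sum_const, Finset.card_univ, Fintype.card_perm, Fintype.card_fin, nsmul_eq_mul]
  have h1 : (l ! : ℂ) ≠ 0 := by exact_mod_cast l.factorial_ne_zero
  rw [one_div_pow]
  field_simp

end Heine

/-! ### The values of the Toeplitz determinants -/

section Conclusion

open PowerSeries

lemma DTilde_natCast (t a b : ℝ) (l : ℕ) :
    DTilde t a b l = unitaryAverage l fun θ => ∏ j, sourceSymbol t a b (θ j) := by
  change unitaryAverage l _ = _
  congr 1
  ext θ
  rw [Finset.mul_sum, Complex.exp_sum, ← Finset.prod_mul_distrib]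
  rfl

/-- The Toeplitz determinant of power series takes the value `DTilde t a b l` at `t`. -/
lemma hasSum_coeff_det_edgeMatrix (t a b : ℝ) (l : ℕ) :
    ∃ D : ℝ, (D : ℂ) = DTilde t a b l ∧
      HasSum (fun k => coeff k (edgeMatrix t a b l).det * t ^ k) D := by
  have hre : ∀ d : ℤ, ∃ c : ℝ, ((c : ℂ) = 1 / (2 * (Real.pi : ℂ)) *
      ∫ θ in Set.Ioc (-Real.pi) Real.pi,
        sourceSymbol t a b θ * Complex.exp (Complex.I * θ) ^ (-d)) ∧
      HasSum (fun k => coeff k (edgeSeries t a b d) * t ^ k) c := fun d => by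
    have h := hasSum_coeff_edgeSeries t a b d
    have hs := Complex.summable_ofReal.1 h.summable
    exact ⟨_, (Complex.hasSum_ofReal.2 hs.hasSum).unique h, hs.hasSum⟩
  choose c hc hs using hre
  refine ⟨(Matrix.of fun i j : Fin l => c ((j : ℤ) - i)).det, ?_,
    hasSum_coeff_det t fun i j => hs _⟩
  rw [DTilde_natCast, unitaryAverage_prod l (continuous_sourceSymbol t a b),
    ← Complex.ofRealHom_eq_coe, RingHom.map_det]
  congr 1
  ext i j
  exact hc _

lemma hasSum_coeff_edgeMatrix_sub (t a b : ℝ) (l : ℕ) :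
    ∃ D : ℝ, (D : ℂ) = DTilde t a b l - a * b * DTilde t a b ((l : ℤ) - 1) ∧
      HasSum (fun N => t ^ N * coeff N ((edgeMatrix t a b l).det -
        C (a * b) * if l = 0 then 0 else (edgeMatrix t a b (l - 1)).det)) D := by
  obtain ⟨D, hD, hs⟩ := hasSum_coeff_det_edgeMatrix t a b l
  cases l with
  | zero =>
    refine ⟨D, ?_, hs.congr_fun fun N => ?_⟩
    · -- `DTilde` vanishes at `-1`.
      change (D : ℂ) = _ - a * b * 0
      rw [hD, mul_zero, sub_zero]
    · rw [if_pos rfl, mul_zero, sub_zero, mul_comm]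
  | succ l =>
    obtain ⟨D', hD', hs'⟩ := hasSum_coeff_det_edgeMatrix t a b l
    refine ⟨D - a * b * D', ?_, (hs.sub (hs'.mul_left (a * b))).congr_fun fun N => ?_⟩
    · rw [Nat.cast_succ, add_sub_cancel_right]
      push_cast
      rw [hD, hD', Nat.cast_succ]
    · rw [if_neg l.succ_ne_zero, map_sub, coeff_C_mul, Nat.add_sub_cancel]
      ring

end Conclusion

end HammersleySources

end

theorem mainTheorem4 {Ω : Type*} [MeasurableSpace Ω] (P : Measure Ω) (t αp αm : ℝ≥0)
    (bulk : Ω → ℕ × (ℕ → I × I)) (left bottom : Ω → ℕ × (ℕ → I))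
    (hlaw : HasLaw (fun ω => (bulk ω, left ω, bottom ω)) (hammersleySourceLaw t αp αm) P)
    (l : ℕ) :
    ((P.real {ω | longestPath (sourcePoints (bulk ω) (left ω) (bottom ω)) ≤ l} : ℝ) : ℂ) =
      Complex.exp (-((αp : ℝ) + (αm : ℝ)) * (t : ℝ) - (t : ℝ) ^ 2) *
        (DTilde t αp αm l - (αp : ℝ) * (αm : ℝ) * DTilde t αp αm ((l : ℤ) - 1)) := by
  obtain ⟨hnonneg, hsum⟩ := HammersleySources.hammersleySourceLaw_eq_tsum t αp αm l
  obtain ⟨D, hD, hs⟩ := HammersleySources.hasSum_coeff_edgeMatrix_sub t αp αm l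
  have hmeas := (HammersleySources.hammersleySourceLaw_eq_expSum t αp αm l).1
  have hnn := fun N => mul_nonneg (pow_nonneg t.coe_nonneg N) (hnonneg N)
  have hP : P {ω | longestPath (sourcePoints (bulk ω) (left ω) (bottom ω)) ≤ l} =
      ENNReal.ofReal (Real.exp (-((αp : ℝ) + αm) * t - t ^ 2) * D) := by
    rw [ENNReal.ofReal_mul (Real.exp_pos _).le, ← hs.tsum_eq,
      ENNReal.ofReal_tsum_of_nonneg hnn hs.summable, ← hsum, ← hlaw.map_eq,
      Measure.map_apply_of_aemeasurable hlaw.aemeasurable hmeas]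
    rfl
  have hD0 : 0 ≤ D := hs.tsum_eq ▸ tsum_nonneg hnn
  rw [measureReal_def, hP, ENNReal.toReal_ofReal (by positivity), ← hD]
  push_cast
  rfl
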